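/- Let $\Lambda$ be an Artin algebra over a commutative artinian ring $k$ and let $X$ be a finitely generated left $\Lambda$-module. Order the subsets of $\mathbb N=\{1,2,\dots\}$ totally by setting $I<J$ if $I\ne J$ and $\min((I\setminus J)\cup(J\setminus I))\in J$. The Gabriel–Roiter measure $\mu(M)$ of a $\Lambda$-module $M$ is the supremum, for this order, of the sets $\{|Y_1|,\dots,|Y_t|\}$, where $Y_1\subset\cdots\subset Y_t$ runs through the finite chains of finitely generated indecomposable submodules of $M$ and $|\cdot|$ denotes composition length. For $I\subseteq\mathbb N$ let $\mathcal A(<I)$ be the class of finitely generated indecomposable $\Lambda$-modules $T$ with $\mu(T)<I$, and let $\mathrm{Rej}(M,\mathcal A(<I))$ be the intersection of the kernels of all homomorphisms from $M$ to modules in $\mathcal A(<I)$. Put $X_1=X$ and $X_{i+1}=X_i/\mathrm{Rej}(X_i,\mathcal A(<\mu(X_i)))$ for $i\ge 1$, let $\overline X=\bigoplus_{i\ge1}X_i$ and $\Gamma=\mathrm{End}_\Lambda(\overline X)$. Let $\Phi$ be a set consisting of exactly one representative of each isomorphism class of indecomposable direct summands of $\overline X$, partially ordered by: $Y\lhd Z$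 if and only if $\mu(Y)>\mu(Z)$. For $Y\in\Phi$ let $P_Y=\mathrm{Hom}_\Lambda(Y,\overline X)$, regarded as a left $\Gamma$-module by postcomposition, let $U_Y\subseteq P_Y$ be the sum of the images of all homomorphisms $P_Z\to P_Y$ with $Z\in\Phi$, $Z\not\trianglelefteq Y$, and let $\Delta_Y=P_Y/U_Y$. Then $\Gamma$, with its natural $k$-algebra structure, is an Artin algebra over $k$, and it is left strongly quasihereditary with respect to $(\Phi,\trianglelefteq)$. That is: $\Gamma$ is semiprimary; the $P_Y$ are indecomposable projective modules with simple tops, and every simple $\Gamma$-module is isomorphic to the top of $P_Y$ for exactly one $Y\in\Phi$; and for every $Y\in\Phi$, (a) $U_Y$ has a finite filtration whose subquotients are of the form $\Delta_Z$ with $Z\rhd Y$; (b) every nonzero homomorphism $P_Y\to\Delta_Y$ is surjective; (c) the projective dimension of $\Delta_Y$ is at most $1$. In particular, $\Gamma$ has finite global dimension. -/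

import Mathlib

universe w u

open CategoryTheory

namespace GabrielRoiter

/-! ### Modules -/

/-- `A` is an Artin algebra over the commutative ring `k`. -/
structure IsArtinAlgebra (k : Type*) (A : Type*) [CommRing k] [Ring A] [Algebra k A] : Prop where
  artinian : IsArtinianRing k
  finite : Module.Finite k A

/-- An indecomposable module: it is nonzero and not the direct sum of two nonzero submodules. -/
def IsIndecomposable (R : Type*) (M : Type*) [Ring R] [AddCommGroup M] [Module R M] : Prop :=
  Nontrivial M ∧ ∀ N N' : Submodule R M, IsCompl N N' → N = ⊥ ∨ N' = ⊥

/-- The top `M / rad M` of a module. -/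
abbrev top (R : Type*) (M : Type*) [Ring R] [AddCommGroup M] [Module R M] : Type _ :=
  M ⧸ Module.jacobson R M

/-- The reject of `M` in the class `Θ`: the intersection of the kernels of all homomorphisms
from `M` to a module in `Θ`. -/
def reject {R : Type u} [Ring R] (M : Type u) [AddCommGroup M] [Module R M]
    (Θ : Set (ModuleCat.{u} R)) : Submodule R M :=
  ⨅ T ∈ Θ, ⨅ f : M →ₗ[R] T, LinearMap.ker f

/-- The (left) global dimension of `R` is finite: some `n` bounds the projective dimension of
every left `R`-module. -/
def HasFiniteGlobalDimension (R : Type u) [Ring R] : Prop :=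
  ∃ n : ℕ, ∀ M : ModuleCat.{u} R, HasProjectiveDimensionLE M n

/-! ### The Gabriel–Roiter measure -/

/-- Sets of natural numbers (as predicates), with the order in which `I < J` if and only if the
least element of the symmetric difference of `I` and `J` lies in `J`; see `measure_lt_iff`. -/
abbrev Measure : Type := Lex (ℕ → Prop)

theorem measure_lt_iff (I J : Set ℕ) :
    (toLex (fun m => m ∈ I) : Measure) < toLex (fun m => m ∈ J) ↔
      ∃ m, m ∈ J ∧ m ∉ I ∧ ∀ l < m, (l ∈ I ↔ l ∈ J) := by
  constructor
  · rintro ⟨m, h, h'⟩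
    have h1 : (m ∈ I) < (m ∈ J) := h'
    rw [lt_iff_le_not_ge] at h1
    refine ⟨m, ?_, fun hI => h1.2 fun _ => hI, fun l hl => iff_of_eq (h l hl)⟩
    by_contra hJ
    exact h1.2 fun h => absurd h hJ
  · rintro ⟨m, hJ, hI, h⟩
    refine ⟨m, fun l hl => propext (h l hl), ?_⟩
    change (m ∈ I) < (m ∈ J)
    rw [lt_iff_le_not_ge]
    exact ⟨fun h => absurd h hI, fun h => hI (h hJ)⟩

/-- The Gabriel–Roiter measure of `M`: the supremum of the sets `{|Y_0|, …, |Y_t|}`, where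
`Y_0 ⊂ ⋯ ⊂ Y_t` runs through the chains of finitely generated indecomposable submodules
of `M` and `|Y|` is the composition length of `Y`. -/
noncomputable def grMeasure (R : Type*) (M : Type*) [Ring R] [AddCommGroup M] [Module R M] :
    Measure :=
  sSup {I | ∃ Y : LTSeries (Submodule R M),
    (∀ i, (Y i).FG ∧ IsIndecomposable R (Y i)) ∧
      I = toLex fun m : ℕ => ∃ i, Module.length R (Y i) = m}

/-- The finitely generated indecomposable modules whose Gabriel–Roiter measure is strictly smaller
than `I`. -/
def indecLT (R : Type u) [Ring R] (I : Measure) : Set (ModuleCat.{u} R) :=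
  {T | Module.Finite R T ∧ IsIndecomposable R T ∧ grMeasure R T < I}

/-- The sequence `X_0 = X`, `X_{i+1} = X_i / Rej(X_i, indecLT (μ(X_i)))` of quotients of `X`
(indexed from `0`). -/
noncomputable def grSeq (R : Type u) [Ring R] (X : Type u) [AddCommGroup X] [Module R X] :
    ℕ → ModuleCat.{u} R
  | 0 => ModuleCat.of R X
  | i + 1 => ModuleCat.of R
      (grSeq R X i ⧸ reject (grSeq R X i) (indecLT R (grMeasure R (grSeq R X i))))

/-- The direct sum of all the modules `X_i`. -/
abbrev grSum (R : Type u) [Ring R] (X : Type u) [AddCommGroup X] [Module R X] : Type u :=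
  DirectSum ℕ fun i => grSeq R X i

/-! ### Quasihereditary rings -/

section Quasihereditary

variable {Γ : Type u} [Ring Γ] {Φ : Type u} (r : Φ → Φ → Prop) (P : Φ → ModuleCat.{u} Γ)

/-- `Φ` labels the simple `Γ`-modules, and `P Y` is the projective indecomposable module whose
simple top has label `Y`. -/
structure LabelsSimples : Prop where
  projective : ∀ Y, Module.Projective Γ (P Y)
  indecomposable : ∀ Y, IsIndecomposable Γ (P Y)
  isSimple_top : ∀ Y, IsSimpleModule Γ (top Γ (P Y))
  eq_of_top_equiv : ∀ Y Z, Nonempty (top Γ (P Y) ≃ₗ[Γ] top Γ (P Z)) → Y = Z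
  exists_top_equiv : ∀ S : ModuleCat.{u} Γ, IsSimpleModule Γ S →
    ∃ Y, Nonempty (S ≃ₗ[Γ] top Γ (P Y))

/-- The trace `U_Y` in `P Y` of the modules `P Z` with `Z ⋬ Y`. -/
def stdKernel (Y : Φ) : Submodule Γ (P Y) :=
  ⨆ (Z : Φ) (_ : ¬ r Z Y) (f : P Z →ₗ[Γ] P Y), LinearMap.range f

/-- The standard module `Δ_Y = P_Y / U_Y`. -/
abbrev Standard (Y : Φ) : Type u := P Y ⧸ stdKernel r P Y

/-- The submodule `U` of `M` has a finite filtration `0 = F 0 ≤ F 1 ≤ ⋯ ≤ F n = U` all of whose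
subquotients `F (i + 1) / F i` are isomorphic to standard modules `Δ_Z` with `Z ∈ S`. -/
def HasStandardFiltration {M : Type u} [AddCommGroup M] [Module Γ M] (U : Submodule Γ M)
    (S : Set Φ) : Prop :=
  ∃ (n : ℕ) (F : ℕ → Submodule Γ M), F 0 = ⊥ ∧ F n = U ∧ ∀ i < n, F i ≤ F (i + 1) ∧
    ∃ Z ∈ S, Nonempty ((F (i + 1) ⧸ (F i).submoduleOf (F (i + 1))) ≃ₗ[Γ] Standard r P Z)

/-- The semiprimary ring `Γ` is quasihereditary with respect to the poset `(Φ, r)`, which labels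
the simple `Γ`-modules through the projective indecomposable modules `P Y`. -/
structure IsQuasihereditary : Prop where
  semiprimary : IsSemiprimaryRing Γ
  partialOrder : IsPartialOrder Φ r
  labels : LabelsSimples P
  filtration : ∀ Y, HasStandardFiltration r P (stdKernel r P Y) {Z | r Y Z ∧ Z ≠ Y}
  surjective : ∀ (Y : Φ) (f : P Y →ₗ[Γ] Standard r P Y), f ≠ 0 → Function.Surjective f

/-- Left strongly quasihereditary: moreover the standard modules have projective dimension at
most one. -/
structure IsLeftStronglyQuasihereditary : Prop extends IsQuasihereditary r P where
  projectiveDimension_le : ∀ Y, HasProjectiveDimensionLE (ModuleCat.of Γ (Standard r P Y)) 1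

end Quasihereditary

/-! ### The labelling poset of an endomorphism ring -/

section EndomorphismRing

variable {R : Type u} [Ring R] {M : Type u} [AddCommGroup M] [Module R M]

/-- `Φ` contains exactly one representative of each isomorphism class of indecomposable direct
summands of `M`. -/
structure IsIndecSummandReps (Φ : Set (Submodule R M)) : Prop where
  isSummand : ∀ Y ∈ Φ, IsIndecomposable R Y ∧ ∃ Y', IsCompl Y Y'
  existsUnique : ∀ Y : Submodule R M, IsIndecomposable R Y → (∃ Y', IsCompl Y Y') →
    ∃! Z, Z ∈ Φ ∧ Nonempty (Y ≃ₗ[R] Z)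

/-- The relation `Y ⊴ Z` on `Φ`, for which `Y ⊲ Z` if and only if `μ(Y) > μ(Z)`. -/
def grLE (Φ : Set (Submodule R M)) (Y Z : Φ) : Prop :=
  Y = Z ∨ grMeasure R Z.1 < grMeasure R Y.1

/-- The left module `P_Y = Hom(Y, M)` over `End(M)`, with action by postcomposition. -/
abbrev homProj (Φ : Set (Submodule R M)) (Y : Φ) : ModuleCat.{u} (Module.End R M) :=
  ModuleCat.of (Module.End R M) (Y.1 →ₗ[R] M)

end EndomorphismRing

end GabrielRoiter

universe v

namespace GabrielRoiter

/-! ### Indecomposable modules of finite length -/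

section Indecomposable

variable {R : Type*} [Ring R]

/-! For `Y` in `Φ` let `K` be its reject in the indecomposables of measure below `μ(Y)`. Everything
follows from two facts about `K`.

First, `Y/K` is a direct sum of members `Z i` of `Φ` with `μ(Z i) < μ(Y)`. Gabriel's main property
(`exists_bijective_or_grMeasure_lt`) shows that an indecomposable module cogenerated by modules of
measure below `I` has measure below `I`. Hence rejects of nonzero modules in their own class are
nonzero, the sequence `X_i` reaches zero, and `Y` must be a summand of some `X_i` with `μ(X_i) =
μ(Y)` (`exists_isRetract_grSeq`). Then `Y/K` is a summand of `X_{i+1}`, and the main property bounds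
the measures of its summands.

Second, a map `Y → Z` between indecomposables with `μ(Z) ≤ μ(Y)` is bijective or kills `K`
(`bijective_or_reject_le_ker`).

Applying `Hom(-, X̄)` to `Y → Y/K ≅ ∏ Z i` embeds `∏ P_{Z i}` in `P_Y` with image the maps that kill
`K`, and by the second fact this image is `U_Y` (`hasStdResolutions_homProj`). So `0 → ∏ P_{Z i} →
P_Y → Δ_Y → 0` is a projective resolution with `Z i ▷ Y`. It gives (c) at once and (a) by induction
on the poset; (b) is the second fact for `Z = Y`. Finite global dimension follows by induction on
labels, since the kernel of `Δ_Y → top P_Y` only receives nonzero maps from `P_Z` with `Z ⊲ Y`. -/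

theorem IsIndecomposable.of_equiv {M N : Type*} [AddCommGroup M] [Module R M] [AddCommGroup N]
    [Module R N] (h : IsIndecomposable R M) (e : M ≃ₗ[R] N) : IsIndecomposable R N := by
  have := h.1
  refine ⟨e.symm.toEquiv.nontrivial, fun A B hAB => ?_⟩
  have hc : IsCompl (A.map e.symm.toLinearMap) (B.map e.symm.toLinearMap) :=
    (Submodule.orderIsoMapComap e.symm).isCompl hAB
  refine (h.2 _ _ hc).imp ?_ ?_ <;> intro h' <;> rwa [Submodule.map_eq_bot_iff] at h'

/-- If `b ∘ a` is invertible, the range of `a` is complemented by the kernel of `b`. -/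
theorem isCompl_range_ker_of_isUnit {M N : Type*} [AddCommGroup M] [Module R M] [AddCommGroup N]
    [Module R N] {a : M →ₗ[R] N} {b : N →ₗ[R] M}
    (h : IsUnit (show Module.End R M from b ∘ₗ a)) :
    IsCompl (LinearMap.range a) (LinearMap.ker b) := by
  obtain ⟨v, hv, hv'⟩ : ∃ v : Module.End R M, (∀ x, v (b (a x)) = x) ∧ ∀ x, b (a (v x)) = x := by
    obtain ⟨v, h1, h2⟩ := isUnit_iff_exists.1 h
    exact ⟨v, fun x => LinearMap.congr_fun h2 x, fun x => LinearMap.congr_fun h1 x⟩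
  refine IsCompl.of_le ?_ ?_
  · rintro _ ⟨⟨x, rfl⟩, hx⟩
    have := hv x
    rw [show b (a x) = 0 from hx, map_zero] at this
    simp [← this]
  · intro y _
    refine Submodule.mem_sup.2 ⟨a (v (b y)), ⟨_, rfl⟩, y - a (v (b y)), ?_, by simp⟩
    simp [hv']

theorem IsIndecomposable.bijective_of_isUnit_comp {M N : Type*} [AddCommGroup M] [Module R M]
    [AddCommGroup N] [Module R N] (hN : IsIndecomposable R N) [Nontrivial M] {a : M →ₗ[R] N}
    {b : N →ₗ[R] M} (h : IsUnit (show Module.End R M from b ∘ₗ a)) : Function.Bijective a := by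
  have hinj : Function.Injective a :=
    Function.Injective.of_comp (f := b) ((Module.End.isUnit_iff _).1 h).1
  have hc := isCompl_range_ker_of_isUnit h
  refine ⟨hinj, LinearMap.range_eq_top.1 ?_⟩
  rcases hN.2 _ _ hc with h0 | h0
  · obtain ⟨x, hx⟩ := exists_ne (0 : M)
    rw [LinearMap.range_eq_bot] at h0
    exact absurd (hinj (by simp [h0])) hx
  · have := hc.codisjoint.eq_top
    rwa [h0, sup_bot_eq] at this

/-- Fitting's lemma: a high power of an endomorphism splits `M` into kernel and range, so every
endomorphism is a unit or nilpotent. -/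
theorem IsIndecomposable.isLocalRing_end {M : Type*} [AddCommGroup M] [Module R M]
    [IsNoetherian R M] [IsArtinian R M] (hM : IsIndecomposable R M) :
    IsLocalRing (Module.End R M) := by
  have := hM.1
  have key : ∀ f : Module.End R M, IsUnit f ∨ IsNilpotent f := by
    intro f
    obtain ⟨n, hn⟩ := (LinearMap.eventually_isCompl_ker_pow_range_pow f).exists_forall_of_atTop
    -- The exponent is kept positive so that invertibility of the power passes to `f`.
    have hc := hn (n + 1) (by omega)
    rcases hM.2 _ _ hc with h | h
    · left
      rw [h] at hc
      have htop : LinearMap.range (f ^ (n + 1)) = ⊤ := by simpa using hc.codisjoint.eq_top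
      have hu : IsUnit (f ^ (n + 1)) := (Module.End.isUnit_iff _).2
        ⟨LinearMap.ker_eq_bot.1 h, LinearMap.range_eq_top.1 htop⟩
      exact (isUnit_pow_succ_iff).1 hu
    · exact Or.inr ⟨n + 1, LinearMap.range_eq_bot.1 h⟩
  refine IsLocalRing.of_isUnit_or_isUnit_one_sub_self fun f => ?_
  exact (key f).imp id fun h => h.isUnit_one_sub

theorem isUnit_or_isUnit_of_isUnit_add' {A : Type*} [Ring A] [IsLocalRing A] {a b : A}
    (h : IsUnit (a + b)) : IsUnit a ∨ IsUnit b := by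
  obtain ⟨v, hv⟩ := h
  have h1 : (↑v⁻¹ * a) + (↑v⁻¹ * b) = 1 := by rw [← mul_add, ← hv]; simp
  refine (IsLocalRing.isUnit_or_isUnit_of_add_one h1).imp ?_ ?_ <;>
    exact fun h => (Units.isUnit_units_mul _ _).1 h

theorem exists_isUnit_of_isUnit_sum {A : Type*} [Ring A] [IsLocalRing A] {ι : Type*}
    (s : Finset ι) (f : ι → A) (h : IsUnit (∑ i ∈ s, f i)) : ∃ i ∈ s, IsUnit (f i) := by
  classical
  induction s using Finset.induction_on with
  | empty => simp at h
  | insert i s hi ih =>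
    rw [Finset.sum_insert hi] at h
    rcases isUnit_or_isUnit_of_isUnit_add' h with h | h
    · exact ⟨i, by simp, h⟩
    · obtain ⟨j, hj, h⟩ := ih h
      exact ⟨j, by simp [hj], h⟩

/-- Every module of finite length is a finite direct sum of indecomposable modules. -/
theorem exists_equiv_pi_indecomposable (R : Type*) [Ring R] (M : Type u) [AddCommGroup M]
    [Module R M] [IsNoetherian R M] [IsArtinian R M] :
    ∃ (ι : Type) (_ : Fintype ι) (W : ι → ModuleCat.{u} R),
      (∀ i, IsIndecomposable R (W i)) ∧ Nonempty (M ≃ₗ[R] ∀ i, W i) := by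
  induction hl : Module.length R M using WellFoundedLT.induction generalizing M with
  | ind l ih =>
  subst hl
  by_cases h0 : Subsingleton M
  · exact ⟨Empty, inferInstance, fun i => i.elim, fun i => i.elim,
      ⟨⟨0, 0, fun _ => Subsingleton.elim _ _, fun _ => Subsingleton.elim _ _⟩⟩⟩
  have := not_subsingleton_iff_nontrivial.1 h0
  by_cases hM : IsIndecomposable R M
  · exact ⟨Unit, inferInstance, fun _ => ModuleCat.of R M, fun _ => hM,
      ⟨(LinearEquiv.funUnique Unit R M).symm⟩⟩
  · obtain ⟨A, B, hAB, hA, hB⟩ :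
        ∃ A B : Submodule R M, IsCompl A B ∧ A ≠ ⊥ ∧ B ≠ ⊥ := by
      by_contra! h
      exact hM ⟨this, fun A B hAB => or_iff_not_imp_left.2 (h A B hAB)⟩
    have hA' : A ≠ ⊤ := fun h => hB (by simpa [h] using hAB.inf_eq_bot)
    have hB' : B ≠ ⊤ := fun h => hA (by simpa [h] using hAB.inf_eq_bot)
    obtain ⟨ι, _, V, hV, ⟨e⟩⟩ := ih _ (Submodule.length_lt hA') A rfl
    obtain ⟨κ, _, W, hW, ⟨e'⟩⟩ := ih _ (Submodule.length_lt hB') B rfl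
    refine ⟨ι ⊕ κ, inferInstance, Sum.elim V W, ?_, ⟨?_⟩⟩
    · rintro (i | i)
      exacts [hV i, hW i]
    · exact (Submodule.prodEquivOfIsCompl A B hAB).symm ≪≫ₗ (e.prodCongr e') ≪≫ₗ
        (LinearEquiv.sumPiEquivProdPi R ι κ
          fun i => ((Sum.elim V W i : ModuleCat.{u} R) : Type u)).symm

end Indecomposable

/-! ### The order on `Measure` -/

theorem Measure.lt_iff (I J : Measure) :
    I < J ↔ ∃ m, ofLex J m ∧ ¬ ofLex I m ∧ ∀ l < m, (ofLex I l ↔ ofLex J l) :=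
  measure_lt_iff {m | ofLex I m} {m | ofLex J m}

theorem Measure.le_of_imp {I J : Measure} (h : ∀ m, ofLex I m → ofLex J m) : I ≤ J := by
  refine le_of_not_gt fun hlt => ?_
  obtain ⟨m, h1, h2, -⟩ := (Measure.lt_iff _ _).1 hlt
  exact h2 (h m h1)

theorem Measure.lt_of_imp {I J : Measure} (h : ∀ m, ofLex I m → ofLex J m) {m : ℕ}
    (hJ : ofLex J m) (hI : ¬ ofLex I m) : I < J :=
  (Measure.le_of_imp h).lt_of_ne fun he => hI (he ▸ hJ)

/-! ### Chains of indecomposable submodules -/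

section Chains

variable {R : Type*} [Ring R] {M : Type*} [AddCommGroup M] [Module R M] {N : Type*}
  [AddCommGroup N] [Module R N]

/-- A chain of finitely generated indecomposable submodules. -/
def IsGRChain (Y : LTSeries (Submodule R M)) : Prop :=
  ∀ i, (Y i).FG ∧ IsIndecomposable R (Y i)

/-- The set of lengths of the members of a chain of submodules. -/
noncomputable def chainSet (Y : LTSeries (Submodule R M)) : Measure :=
  toLex fun m : ℕ => ∃ i, Module.length R (Y i) = m

theorem ofLex_chainSet (Y : LTSeries (Submodule R M)) (m : ℕ) :
    ofLex (chainSet Y) m ↔ ∃ i, Module.length R (Y i) = m := Iff.rfl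

theorem IsGRChain.le_grMeasure {Y : LTSeries (Submodule R M)} (hY : IsGRChain Y) :
    chainSet Y ≤ grMeasure R M :=
  le_sSup ⟨Y, hY, rfl⟩

theorem IsGRChain.map {Y : LTSeries (Submodule R N)} (hY : IsGRChain Y) {f : N →ₗ[R] M}
    (hf : Function.Injective f) :
    IsGRChain (Y.map (Submodule.map f) (Submodule.map_strictMono_of_injective hf)) ∧
      chainSet (Y.map (Submodule.map f) (Submodule.map_strictMono_of_injective hf)) =
        chainSet Y := by
  refine ⟨fun i => ⟨(hY i).1.map f, (hY i).2.of_equiv (Submodule.equivMapOfInjective f hf _)⟩, ?_⟩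
  refine congrArg toLex (funext fun m => propext (exists_congr fun i => ?_))
  exact iff_of_eq (congrArg (· = _) (Submodule.equivMapOfInjective f hf (Y i)).length_eq.symm)

theorem grMeasure_le_of_injective {f : N →ₗ[R] M} (hf : Function.Injective f) :
    grMeasure R N ≤ grMeasure R M := by
  refine sSup_le ?_
  rintro _ ⟨Y, hY, rfl⟩
  have h := IsGRChain.map (Y := Y) hY hf
  exact h.2.symm.le.trans h.1.le_grMeasure

theorem grMeasure_eq_of_equiv (e : N ≃ₗ[R] M) : grMeasure R N = grMeasure R M :=
  le_antisymm (grMeasure_le_of_injective (f := e.toLinearMap) e.injective)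
    (grMeasure_le_of_injective (f := e.symm.toLinearMap) e.symm.injective)

/-- A chain of submodules of `M` is a chain of submodules of each submodule that contains it. -/
theorem IsGRChain.le_grMeasure_of_last_le {Y : LTSeries (Submodule R M)} (hY : IsGRChain Y)
    {A : Submodule R M} (hA : Y.last ≤ A) : chainSet Y ≤ grMeasure R A := by
  have hle : ∀ i, Y i ≤ A := fun i => (Y.monotone (Fin.le_last i)).trans hA
  let Z : LTSeries (Submodule R A) := LTSeries.mk Y.length (fun i => (Y i).comap A.subtype)
    fun i j hij => lt_of_le_not_ge (Submodule.comap_mono (Y.strictMono hij).le) fun h =>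
      (Y.strictMono hij).not_ge fun x hx => h (x := ⟨x, hle j hx⟩) hx
  have e : ∀ i, Z i ≃ₗ[R] Y i := fun i => Submodule.comapSubtypeEquivOfLe (hle i)
  have hZ : IsGRChain Z := fun i => by
    refine ⟨?_, (hY i).2.of_equiv (e i).symm⟩
    rw [← Module.Finite.iff_fg]
    have := Module.Finite.iff_fg.2 (hY i).1
    exact Module.Finite.equiv (e i).symm
  refine le_trans (le_of_eq ?_) hZ.le_grMeasure
  refine congrArg toLex (funext fun m => propext (exists_congr fun i => ?_))
  exact iff_of_eq (congrArg (· = _) (e i).length_eq.symm)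

theorem IsGRChain.snoc {Y : LTSeries (Submodule R M)} (hY : IsGRChain Y) {A : Submodule R M}
    (hlt : Y.last < A) (hfg : A.FG) (hA : IsIndecomposable R A) :
    IsGRChain (RelSeries.snoc Y A hlt) := by
  intro i
  have : RelSeries.snoc Y A hlt i ∈ RelSeries.snoc Y A hlt := ⟨i, rfl⟩
  rcases RelSeries.mem_snoc.1 this with ⟨j, hj⟩ | h
  · rw [← hj]
    exact hY j
  · rw [h]
    exact ⟨hfg, hA⟩

theorem ofLex_chainSet' (Y : LTSeries (Submodule R M)) (m : ℕ) :
    ofLex (chainSet Y) m ↔ ∃ A ∈ Y, Module.length R A = m := by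
  rw [ofLex_chainSet]
  constructor
  · rintro ⟨i, hi⟩
    exact ⟨_, ⟨i, rfl⟩, hi⟩
  · rintro ⟨_, ⟨i, rfl⟩, hi⟩
    exact ⟨i, hi⟩

theorem ofLex_chainSet_snoc (Y : LTSeries (Submodule R M)) {A : Submodule R M}
    (hlt : Y.last < A) (m : ℕ) :
    ofLex (chainSet (RelSeries.snoc Y A hlt)) m ↔
      ofLex (chainSet Y) m ∨ Module.length R A = m := by
  simp only [ofLex_chainSet', RelSeries.mem_snoc]
  constructor
  · rintro ⟨B, hB | rfl, h⟩
    exacts [Or.inl ⟨B, hB, h⟩, Or.inr h]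
  · rintro (⟨B, hB, h⟩ | h)
    exacts [⟨B, Or.inl hB, h⟩, ⟨A, Or.inr rfl, h⟩]

theorem isIndecomposable_top (hM : IsIndecomposable R M) :
    IsIndecomposable R (⊤ : Submodule R M) :=
  hM.of_equiv Submodule.topEquiv.symm

/-! ### Measures of modules of finite length -/

section FiniteLength

variable [IsNoetherian R M] [IsArtinian R M] [IsNoetherian R N] [IsArtinian R N]

theorem length_lt_of_lt {A B : Submodule R M} (h : A < B) :
    Module.length R A < Module.length R B := by
  rw [Module.length_submodule, Module.length_submodule]
  exact Submodule.height_strictMono h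

theorem ofLex_chainSet_le {Y : LTSeries (Submodule R M)} {m : ℕ} (h : ofLex (chainSet Y) m) :
    (m : ℕ∞) ≤ Module.length R Y.last := by
  obtain ⟨i, hi⟩ := h
  rw [← hi]
  rcases (Y.monotone (Fin.le_last i)).eq_or_lt with h | h
  · exact le_of_eq (by rw [h]; rfl)
  · exact (length_lt_of_lt h).le

theorem exists_isIndecomposable_submodule (R M : Type*) [Ring R] [AddCommGroup M] [Module R M]
    [IsArtinian R M] [Nontrivial M] :
    ∃ A : Submodule R M, IsIndecomposable R A := by
  obtain ⟨A, hA⟩ := IsAtomic.exists_atom (Submodule R M)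
  have : IsSimpleModule R A := isSimpleModule_iff_isAtom.2 hA
  refine ⟨A, IsSimpleModule.nontrivial R A, fun B C hBC => ?_⟩
  refine (eq_bot_or_eq_top B).imp id fun h => ?_
  simpa [h] using hBC.inf_eq_bot

/-- The supremum that defines the Gabriel–Roiter measure is attained. -/
theorem exists_chainSet_eq_grMeasure (R M : Type*) [Ring R] [AddCommGroup M] [Module R M]
    [IsNoetherian R M] [IsArtinian R M] [Nontrivial M] :
    ∃ Y : LTSeries (Submodule R M), IsGRChain Y ∧ chainSet Y = grMeasure R M := by
  obtain ⟨n, hn⟩ := ENat.ne_top_iff_exists.1 (Module.length_ne_top (R := R) (M := M))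
  set S : Set Measure := {I | ∃ Y : LTSeries (Submodule R M), IsGRChain Y ∧ I = chainSet Y}
  have hS : S.Nonempty := by
    obtain ⟨A, hA⟩ := exists_isIndecomposable_submodule R M
    exact ⟨_, RelSeries.singleton _ A, fun i => ⟨IsNoetherian.noetherian A, hA⟩, rfl⟩
  -- Chain sets are subsets of `{0, …, n}` with `n = |M|`, so the supremum runs over a finite
  -- nonempty set in a linear order.
  have hfin : S.Finite := by
    refine Set.Finite.subset (Set.Finite.image (fun s : Set ℕ => (toLex fun m => m ∈ s : Measure))
      (Set.finite_Iic n).finite_subsets) ?_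
    rintro _ ⟨Y, hY, rfl⟩
    refine ⟨{m | ofLex (chainSet Y) m}, fun m hm => ?_, rfl⟩
    have h1 := ofLex_chainSet_le hm
    have h2 : Module.length R Y.last ≤ Module.length R M :=
      Module.length_le_of_injective Y.last.subtype Subtype.val_injective
    rw [← hn] at h2
    exact_mod_cast h1.trans h2
  obtain ⟨Y, hY, h⟩ := hS.csSup_mem hfin
  exact ⟨Y, hY, h.symm⟩

theorem ofLex_grMeasure_le [Nontrivial M] {m : ℕ} (h : ofLex (grMeasure R M) m) :
    (m : ℕ∞) ≤ Module.length R M := by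
  obtain ⟨Y, -, hY⟩ := exists_chainSet_eq_grMeasure R M
  rw [← hY] at h
  exact (ofLex_chainSet_le h).trans
    (Module.length_le_of_injective Y.last.subtype Subtype.val_injective)

/-- The Gabriel–Roiter measure of `M` is the measure of an indecomposable submodule. -/
theorem exists_isIndecomposable_submodule_grMeasure_eq [Nontrivial M] :
    ∃ A : Submodule R M, IsIndecomposable R A ∧ grMeasure R A = grMeasure R M := by
  obtain ⟨Y, hY, h⟩ := exists_chainSet_eq_grMeasure R M
  refine ⟨Y.last, (hY _).2, le_antisymm (grMeasure_le_of_injective Y.last.subtype_injective) ?_⟩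
  rw [← h]
  exact hY.le_grMeasure_of_last_le le_rfl

/-- Appending `⊤` to the chain adds the number `|M|`, which exceeds every length already present. -/
theorem chainSet_lt_grMeasure (hM : IsIndecomposable R M) {Y : LTSeries (Submodule R M)}
    (hY : IsGRChain Y) (hlt : Y.last < ⊤) : chainSet Y < grMeasure R M := by
  obtain ⟨n, hn⟩ := ENat.ne_top_iff_exists.1 (Module.length_ne_top (R := R) (M := M))
  refine lt_of_lt_of_le ?_
    (hY.snoc hlt (IsNoetherian.noetherian _) (isIndecomposable_top hM)).le_grMeasure
  refine Measure.lt_of_imp (m := n) (fun m hm => (ofLex_chainSet_snoc _ hlt _).2 (Or.inl hm))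
    ((ofLex_chainSet_snoc _ hlt _).2 (Or.inr (by rw [Module.length_top, hn]))) fun h => ?_
  have h1 := ofLex_chainSet_le h
  have h2 := length_lt_of_lt hlt
  rw [Module.length_top, ← hn] at h2
  exact h2.not_ge h1

/-- The measure of a proper submodule of an indecomposable module is smaller. -/
theorem grMeasure_lt_of_injective [Nontrivial N] (hM : IsIndecomposable R M) {f : N →ₗ[R] M}
    (hf : Function.Injective f) (hf' : ¬ Function.Surjective f) :
    grMeasure R N < grMeasure R M := by
  obtain ⟨Y, hY, h⟩ := exists_chainSet_eq_grMeasure R N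
  rw [← h, ← (hY.map hf).2]
  refine chainSet_lt_grMeasure hM (hY.map hf).1 (lt_top_iff_ne_top.2 fun htop => hf' ?_)
  have h1 : Submodule.map f Y.last = ⊤ := htop
  refine LinearMap.range_eq_top.1 (top_le_iff.1 ?_)
  rw [← h1]
  exact LinearMap.map_le_range

/-- The measure of an indecomposable module `M` arises from that of a proper submodule by adding
the length of `M`. -/
theorem grMeasure_eq_insert_length (hM : IsIndecomposable R M) :
    ∃ I : Measure, (∀ m, ofLex (grMeasure R M) m ↔ ofLex I m ∨ Module.length R M = m) ∧
      ((∀ m, ¬ ofLex I m) ∨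
        ∃ A : Submodule R M, A < ⊤ ∧ IsIndecomposable R A ∧ I ≤ grMeasure R A) := by
  have := hM.1
  obtain ⟨Y, hY, h⟩ := exists_chainSet_eq_grMeasure R M
  have hlast : Y.last = ⊤ := by
    by_contra hne
    exact (chainSet_lt_grMeasure hM hY (lt_top_iff_ne_top.2 hne)).ne h
  by_cases h0 : Y.length = 0
  · refine ⟨toLex fun _ => False, fun m => ?_, Or.inl fun m h => h⟩
    rw [← h, ofLex_chainSet]
    have hi : ∀ i, Y i = ⊤ := fun i => by
      rw [← hlast, RelSeries.last]
      congr 1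
      exact Fin.ext (by have := i.2; simp; omega)
    constructor
    · rintro ⟨i, hm⟩
      rw [hi, Module.length_top] at hm
      exact Or.inr hm
    · rintro (h | h)
      · exact h.elim
      · exact ⟨0, by rw [hi, Module.length_top, h]⟩
  · have hlt : Y.eraseLast.last < Y.last := RelSeries.eraseLast_last_rel_last Y h0
    have hs : RelSeries.snoc Y.eraseLast Y.last hlt = Y := RelSeries.snoc_self_eraseLast Y h0
    have hE : IsGRChain Y.eraseLast := fun i => hY _
    refine ⟨chainSet Y.eraseLast, fun m => ?_, Or.inr ⟨_, hlast ▸ hlt, (hE _).2,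
      hE.le_grMeasure_of_last_le le_rfl⟩⟩
    rw [← h, ← Module.length_top (R := R) (M := M), ← hlast, ← ofLex_chainSet_snoc _ hlt, hs]

/-- The number `|M|` belongs to the measure of an indecomposable `M`, while no member of the measure
of `N` exceeds `|N|`. -/
theorem length_le_of_grMeasure_eq (hM : IsIndecomposable R M) [Nontrivial N]
    (h : grMeasure R M = grMeasure R N) : Module.length R M ≤ Module.length R N := by
  obtain ⟨n, hn⟩ := ENat.ne_top_iff_exists.1 (Module.length_ne_top (R := R) (M := M))
  obtain ⟨I, hI, -⟩ := grMeasure_eq_insert_length hM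
  rw [← hn]
  exact ofLex_grMeasure_le (by rw [← h, hI]; exact Or.inr hn.symm)

end FiniteLength

end Chains

/-! ### Gabriel's main property -/

section MainProperty

/-- The least difference between `I'` and `J` lies in `J`, hence below `n`; inserting `n` changes
nothing up to that point. -/
theorem Measure.lt_of_eq_insert {I I' J : Measure} {n : ℕ}
    (hI : ∀ m, ofLex I m ↔ ofLex I' m ∨ n = m) (hlt : I' < J) (hJ : ∀ m, ofLex J m → m < n) :
    I < J := by
  obtain ⟨m, h1, h2, h3⟩ := (Measure.lt_iff _ _).1 hlt
  have hm := hJ m h1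
  refine (Measure.lt_iff _ _).2 ⟨m, h1, fun h => ?_, fun l hl => ?_⟩
  · rcases (hI m).1 h with h | h
    exacts [h2 h, hm.ne' h]
  · rw [hI, ← h3 l hl]
    exact or_iff_left (by omega)

variable {R : Type*} [Ring R] [IsArtinianRing R]

/-- If an indecomposable module `X` embeds in a product of indecomposable modules `Y j`, then
one of the coordinates is an isomorphism, or the measure of some `Y j` exceeds that of `X`. -/
theorem exists_bijective_or_grMeasure_lt {X : Type u} [AddCommGroup X] [Module R X]
    [Module.Finite R X] (hX : IsIndecomposable R X) {ι : Type v} (Y : ι → ModuleCat.{u} R)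
    (hfin : ∀ i, Module.Finite R (Y i)) (hY : ∀ i, IsIndecomposable R (Y i))
    (f : ∀ i, X →ₗ[R] Y i) (hf : ⨅ i, LinearMap.ker (f i) = ⊥) :
    (∃ j, Function.Bijective (f j)) ∨ ∃ j, grMeasure R X < grMeasure R (Y j) := by
  induction hl : Module.length R X using WellFoundedLT.induction generalizing X ι with
  | ind l ih =>
  subst hl
  have hnt := hX.1
  obtain ⟨n, hn⟩ := ENat.ne_top_iff_exists.1 (Module.length_ne_top (R := R) (M := X))
  -- The case of surjective coordinates. If none is injective, every `Z j` is shorter than `X`, so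
  -- its measure lies below `n` and it suffices to exceed `I`, the measure of `X` without its last
  -- entry `n`.
  have surj : ∀ {κ : Type v} (Z : κ → ModuleCat.{u} R) (_ : ∀ i, Module.Finite R (Z i))
      (_ : ∀ i, IsIndecomposable R (Z i)) (g : ∀ i, X →ₗ[R] Z i)
      (_ : ⨅ i, LinearMap.ker (g i) = ⊥) (_ : ∀ i, Function.Surjective (g i)),
      (∃ j, Function.Bijective (g j)) ∨ ∃ j, grMeasure R X < grMeasure R (Z j) := by
    intro κ Z hZfin hZ g hg hsurj
    by_cases hinj : ∃ j, Function.Injective (g j)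
    · obtain ⟨j, hj⟩ := hinj
      exact Or.inl ⟨j, hj, hsurj j⟩
    push Not at hinj
    right
    have hlen : ∀ j, Module.length R (Z j) < n := by
      intro j
      have hk : LinearMap.ker (g j) ≠ ⊥ := fun h => hinj j (LinearMap.ker_eq_bot.1 h)
      rw [hn, ← ((g j).quotKerEquivOfSurjective (hsurj j)).length_eq]
      exact Submodule.length_quotient_lt _ hk
    have hJ : ∀ j m, ofLex (grMeasure R (Z j)) m → m < n := by
      intro j m hm
      have := (hZ j).1
      exact_mod_cast (ofLex_grMeasure_le hm).trans_lt (hlen j)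
    obtain ⟨I, hI, hI'⟩ := grMeasure_eq_insert_length hX
    have hI₁ : ∀ m, ofLex (grMeasure R X) m ↔ ofLex I m ∨ n = m := fun m => by
      rw [hI, ← hn, Nat.cast_inj]
    suffices h : ∃ j, I < grMeasure R (Z j) by
      obtain ⟨j, hj⟩ := h
      exact ⟨j, Measure.lt_of_eq_insert hI₁ hj (hJ j)⟩
    rcases hI' with hI' | ⟨A, hA, hAind, hIA⟩
    · obtain ⟨j⟩ : Nonempty κ := by
        by_contra hκ
        rw [not_nonempty_iff] at hκ
        rw [iInf_of_empty] at hg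
        exact top_ne_bot hg
      have := (hZ j).1
      obtain ⟨n', hn'⟩ := ENat.ne_top_iff_exists.1 (Module.length_ne_top (R := R) (M := Z j))
      obtain ⟨I₂, hI₂, -⟩ := grMeasure_eq_insert_length (hZ j)
      exact ⟨j, Measure.lt_of_imp (fun m h => (hI' m h).elim) ((hI₂ n').2 (Or.inr hn'.symm))
        (hI' n')⟩
    -- Induction applies to the proper submodule `A`. A coordinate bijective on `A` would make `A` a
    -- direct summand of `X`, which is impossible, so some `Z j` has measure above that of `A`.
    · have hAker : ⨅ j, LinearMap.ker ((g j).domRestrict A) = ⊥ := by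
        refine (Submodule.eq_bot_iff _).2 fun x hx => ?_
        have : (x : X) ∈ ⨅ i, LinearMap.ker (g i) := by
          rw [Submodule.mem_iInf] at hx ⊢
          exact fun i => hx i
        rw [hg] at this
        exact Subtype.ext this
      rcases ih _ (Submodule.length_lt hA.ne) hAind Z hZfin hZ _ hAker rfl with
        ⟨j, hj⟩ | ⟨j, hj⟩
      · exfalso
        have hc : IsCompl A (LinearMap.ker (g j)) := by
          refine IsCompl.of_le ?_ ?_
          · rintro x ⟨hxA, hx⟩
            have h0 : (g j).domRestrict A ⟨x, hxA⟩ = 0 := hx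
            exact congrArg Subtype.val ((map_eq_zero_iff _ hj.1).1 h0)
          · intro x _
            obtain ⟨a, ha⟩ := hj.2 (g j x)
            refine Submodule.mem_sup.2 ⟨a, a.2, x - a, ?_, by simp⟩
            rw [LinearMap.mem_ker, map_sub, ← ha, LinearMap.domRestrict_apply, sub_self]
        rcases hX.2 _ _ hc with h | h
        · have := hAind.1
          exact (Submodule.nontrivial_iff_ne_bot.1 this) h
        · exact hinj j (LinearMap.ker_eq_bot.1 h)
      · exact ⟨j, hIA.trans_lt hj⟩
  -- Reduction to the surjective case: each `Y i` is replaced by the indecomposable summands of the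
  -- image of `f i`, whose measures do not exceed that of `Y i`.
  choose κ hκ W hW e using fun i => exists_equiv_pi_indecomposable R (LinearMap.range (f i))
  let e' := fun i => (e i).some
  let g : ∀ p : (i : ι) × κ i, X →ₗ[R] W p.1 p.2 := fun p =>
    LinearMap.proj p.2 ∘ₗ (e' p.1).toLinearMap ∘ₗ (f p.1).rangeRestrict
  have hgsurj : ∀ p, Function.Surjective (g p) := fun p =>
    (Function.surjective_eval (α := κ p.1) (β := fun j => (W p.1 j : Type u)) p.2).comp
      ((e' p.1).surjective.comp (f p.1).surjective_rangeRestrict)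
  have hgker : ⨅ p, LinearMap.ker (g p) = ⊥ := by
    refine (Submodule.eq_bot_iff _).2 fun x hx => ?_
    have : x ∈ ⨅ i, LinearMap.ker (f i) := by
      rw [Submodule.mem_iInf] at hx ⊢
      intro i
      have h0 : e' i ((f i).rangeRestrict x) = 0 := funext fun j => hx ⟨i, j⟩
      exact congrArg Subtype.val ((map_eq_zero_iff _ (e' i).injective).1 h0)
    rwa [hf] at this
  have hW' : ∀ p : (i : ι) × κ i,
      grMeasure R (W p.1 p.2) ≤ grMeasure R (LinearMap.range (f p.1)) := by
    classical
    intro p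
    exact grMeasure_le_of_injective (f := (e' p.1).symm.toLinearMap ∘ₗ
      LinearMap.single R (fun j => (W p.1 j : Type u)) p.2)
      ((e' p.1).symm.injective.comp (LinearMap.ker_eq_bot.1 (LinearMap.ker_single R _ p.2)))
  have hle : ∀ i, grMeasure R (LinearMap.range (f i)) ≤ grMeasure R (Y i) := fun i =>
    grMeasure_le_of_injective (Submodule.subtype_injective _)
  rcases surj (fun p : (i : ι) × κ i => W p.1 p.2)
    (fun p => Module.Finite.of_surjective _ (hgsurj p))
    (fun p => hW p.1 p.2) g hgker hgsurj with ⟨p, hp⟩ | ⟨p, hp⟩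
  · have hinj : Function.Injective (f p.1) := fun x y hxy => hp.1 (by
      change e' p.1 ((f p.1).rangeRestrict x) p.2 = e' p.1 ((f p.1).rangeRestrict y) p.2
      rw [show (f p.1).rangeRestrict x = (f p.1).rangeRestrict y from Subtype.ext hxy])
    by_cases hs : Function.Surjective (f p.1)
    · exact Or.inl ⟨p.1, hinj, hs⟩
    · have := hfin p.1
      exact Or.inr ⟨p.1, grMeasure_lt_of_injective (hY _) hinj hs⟩
  · exact Or.inr ⟨p.1, hp.trans_le ((hW' p).trans (hle _))⟩

end MainProperty

/-! ### The reject -/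

section Reject

variable {R : Type u} [Ring R]

theorem mem_reject {M : Type u} [AddCommGroup M] [Module R M] {Θ : Set (ModuleCat.{u} R)}
    {x : M} : x ∈ reject M Θ ↔ ∀ T ∈ Θ, ∀ f : M →ₗ[R] T, f x = 0 := by
  simp [reject, Submodule.mem_iInf]

theorem map_mem_reject {M N : Type u} [AddCommGroup M] [Module R M] [AddCommGroup N] [Module R N]
    {Θ : Set (ModuleCat.{u} R)} (f : M →ₗ[R] N) {x : M} (hx : x ∈ reject M Θ) :
    f x ∈ reject N Θ :=
  mem_reject.2 fun T hT g => mem_reject.1 hx T hT (g ∘ₗ f)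

theorem reject_eq_bot_of_mem {M : Type u} [AddCommGroup M] [Module R M] {Θ : Set (ModuleCat.{u} R)}
    (h : ModuleCat.of R M ∈ Θ) : reject M Θ = ⊥ :=
  (Submodule.eq_bot_iff _).2 fun _ hx => mem_reject.1 hx _ h LinearMap.id

theorem reject_quotient_reject {M : Type u} [AddCommGroup M] [Module R M]
    (Θ : Set (ModuleCat.{u} R)) : reject (M ⧸ reject M Θ) Θ = ⊥ := by
  refine (Submodule.eq_bot_iff _).2 fun y hy => ?_
  obtain ⟨x, rfl⟩ := Submodule.Quotient.mk_surjective _ y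
  rw [Submodule.Quotient.mk_eq_zero]
  refine mem_reject.2 fun T hT f => ?_
  exact mem_reject.1 hy T hT ((reject M Θ).liftQ f fun z hz => mem_reject.1 hz T hT f)

theorem reject_eq_bot_of_injective {M N : Type u} [AddCommGroup M] [Module R M] [AddCommGroup N]
    [Module R N] {Θ : Set (ModuleCat.{u} R)} {f : M →ₗ[R] N} (hf : Function.Injective f)
    (h : reject N Θ = ⊥) : reject M Θ = ⊥ :=
  (Submodule.eq_bot_iff _).2 fun _ hx => (map_eq_zero_iff f hf).1
    (by simpa [h] using map_mem_reject f hx)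

variable [IsArtinianRing R]

/-- An indecomposable module cogenerated by modules of measure smaller than `I` has measure
smaller than `I`. -/
theorem grMeasure_lt_of_reject_eq_bot {X : Type u} [AddCommGroup X] [Module R X]
    [Module.Finite R X] (hX : IsIndecomposable R X) {I : Measure}
    (h : reject X (indecLT R I) = ⊥) : grMeasure R X < I := by
  have hker : ⨅ p : (T : indecLT R I) × (X →ₗ[R] T.1), LinearMap.ker p.2 = ⊥ := by
    refine (Submodule.eq_bot_iff _).2 fun x hx => ?_
    rw [Submodule.mem_iInf] at hx
    have : x ∈ reject X (indecLT R I) := mem_reject.2 fun T hT f => hx ⟨⟨T, hT⟩, f⟩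
    rwa [h] at this
  rcases exists_bijective_or_grMeasure_lt hX (fun p : (T : indecLT R I) × (X →ₗ[R] T.1) => p.1.1)
    (fun p => p.1.2.1) (fun p => p.1.2.2.1) (fun p => p.2) hker with ⟨p, hp⟩ | ⟨p, hp⟩
  · rw [grMeasure_eq_of_equiv (LinearEquiv.ofBijective p.2 hp)]
    exact p.1.2.2.2
  · exact hp.trans p.1.2.2.2

/-- A nonzero module is not cogenerated by modules of smaller measure. -/
theorem reject_grMeasure_ne_bot (X : Type u) [AddCommGroup X] [Module R X]
    [Module.Finite R X] [Nontrivial X] : reject X (indecLT R (grMeasure R X)) ≠ ⊥ := by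
  intro h
  -- An indecomposable submodule of the same measure would be cogenerated as well, and so would have
  -- measure smaller than its own.
  obtain ⟨A, hA, hA'⟩ := exists_isIndecomposable_submodule_grMeasure_eq (R := R) (M := X)
  exact (grMeasure_lt_of_reject_eq_bot hA
    (reject_eq_bot_of_injective A.subtype_injective h)).ne hA'

/-- A homomorphism between indecomposable modules that does not increase the measure is an
isomorphism or vanishes on the reject. -/
theorem bijective_or_reject_le_ker {Y Z : Type u} [AddCommGroup Y] [Module R Y] [Module.Finite R Y]
    [AddCommGroup Z] [Module R Z] [Module.Finite R Z] (hY : IsIndecomposable R Y)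
    (hZ : IsIndecomposable R Z) (hle : grMeasure R Z ≤ grMeasure R Y) (f : Y →ₗ[R] Z) :
    Function.Bijective f ∨ reject Y (indecLT R (grMeasure R Y)) ≤ LinearMap.ker f := by
  classical
  have := hZ.1
  rcases hle.lt_or_eq with hlt | heq
  · exact Or.inr fun x hx => mem_reject.1 hx (ModuleCat.of R Z) ⟨‹_›, hZ, hlt⟩ f
  by_cases hf : Function.Surjective f
  · left
    refine ⟨LinearMap.ker_eq_bot.1 ?_, hf⟩
    by_contra hk
    have h1 := Submodule.length_quotient_lt _ hk
    rw [(f.quotKerEquivOfSurjective hf).length_eq] at h1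
    exact h1.not_ge (length_le_of_grMeasure_eq hY heq.symm)
  · right
    -- The image is proper, so each of its indecomposable summands embeds properly in `Z` and has
    -- measure below `μ(Z) = μ(Y)`; every coordinate of `f` therefore kills the reject.
    obtain ⟨ι, _, W, hW, ⟨e⟩⟩ := exists_equiv_pi_indecomposable R (LinearMap.range f)
    intro x hx
    suffices h : e (f.rangeRestrict x) = 0 from
      congrArg Subtype.val ((map_eq_zero_iff _ e.injective).1 h)
    funext i
    have := (hW i).1
    let j : W i →ₗ[R] LinearMap.range f :=
      e.symm.toLinearMap ∘ₗ LinearMap.single R (fun j => (W j : Type u)) i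
    have hj : Function.Injective j :=
      e.symm.injective.comp (LinearMap.ker_eq_bot.1 (LinearMap.ker_single R _ i))
    have hfi : Module.Finite R (W i) := Module.Finite.of_injective j hj
    refine mem_reject.1 hx (W i) ⟨hfi, hW i, ?_⟩
      (LinearMap.proj i ∘ₗ e.toLinearMap ∘ₗ f.rangeRestrict)
    rw [← heq]
    refine grMeasure_lt_of_injective hZ (f := (LinearMap.range f).subtype ∘ₗ j)
      ((Submodule.subtype_injective _).comp hj) fun hs => hf fun z => ?_
    obtain ⟨w, rfl⟩ := hs z
    exact (j w).2

end Reject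

/-! ### Retracts -/

section Retract

variable {R : Type*} [Ring R]

/-- `M` is isomorphic to a direct summand of `N`. -/
def IsRetract (R M N : Type*) [Ring R] [AddCommGroup M] [Module R M] [AddCommGroup N]
    [Module R N] : Prop :=
  ∃ (s : M →ₗ[R] N) (p : N →ₗ[R] M), p ∘ₗ s = LinearMap.id

variable {M N L : Type*} [AddCommGroup M] [Module R M] [AddCommGroup N] [Module R N]
  [AddCommGroup L] [Module R L]

theorem IsRetract.trans (h : IsRetract R M N) (h' : IsRetract R N L) : IsRetract R M L := by
  obtain ⟨s, p, h⟩ := h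
  obtain ⟨s', p', h'⟩ := h'
  refine ⟨s' ∘ₗ s, p ∘ₗ p', LinearMap.ext fun x => ?_⟩
  exact (congrArg p (LinearMap.congr_fun h' (s x))).trans (LinearMap.congr_fun h x)

theorem IsRetract.of_equiv (e : M ≃ₗ[R] N) : IsRetract R M N :=
  ⟨e, e.symm, by ext; simp⟩

theorem IsRetract.of_equiv_pi {ι : Type*} {W : ι → Type*} [∀ i, AddCommGroup (W i)]
    [∀ i, Module R (W i)] (e : M ≃ₗ[R] ∀ i, W i) (i : ι) : IsRetract R (W i) M := by
  classical
  refine ⟨e.symm.toLinearMap ∘ₗ LinearMap.single R W i, LinearMap.proj i ∘ₗ e.toLinearMap, ?_⟩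
  ext x
  simp

theorem IsRetract.grMeasure_le (h : IsRetract R M N) : grMeasure R M ≤ grMeasure R N := by
  obtain ⟨s, p, h⟩ := h
  exact grMeasure_le_of_injective (f := s)
    (Function.LeftInverse.injective (g := p) fun x => LinearMap.congr_fun h x)

theorem IsRetract.finite (h : IsRetract R M N) [Module.Finite R N] : Module.Finite R M := by
  obtain ⟨s, p, h⟩ := h
  exact Module.Finite.of_surjective p
    (Function.RightInverse.surjective (g := s) fun x => LinearMap.congr_fun h x)

theorem IsRetract.of_isCompl {A B : Submodule R M} (h : IsCompl A B) : IsRetract R A M :=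
  ⟨A.subtype, A.projectionOnto B h, by ext; simp⟩

/-- An indecomposable direct summand of a finite direct sum is a direct summand of a term. -/
theorem IsIndecomposable.exists_isRetract [IsNoetherian R M] [IsArtinian R M]
    (hM : IsIndecomposable R M) {ι : Type*} (t : Finset ι) {W : ι → Type*}
    [∀ i, AddCommGroup (W i)] [∀ i, Module R (W i)] (a : ∀ i, M →ₗ[R] W i)
    (b : ∀ i, W i →ₗ[R] M) (h : ∑ i ∈ t, b i ∘ₗ a i = LinearMap.id) :
    ∃ i ∈ t, IsRetract R M (W i) := by
  have := hM.isLocalRing_end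
  obtain ⟨i, hi, hu⟩ := exists_isUnit_of_isUnit_sum (A := Module.End R M) t
    (fun i => b i ∘ₗ a i) (h ▸ isUnit_one)
  obtain ⟨v, hv⟩ := isUnit_iff_exists.1 hu
  exact ⟨i, hi, a i, v ∘ₗ b i, hv.2⟩

end Retract

/-! ### Representatives of the indecomposable summands -/

section Representatives

variable {R : Type u} [Ring R] {M : Type u} [AddCommGroup M] [Module R M]
  {Φ : Set (Submodule R M)}

theorem IsIndecSummandReps.isRetract (hΦ : IsIndecSummandReps Φ) (Y : Φ) : IsRetract R Y.1 M := by
  obtain ⟨Y', h⟩ := (hΦ.isSummand _ Y.2).2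
  exact IsRetract.of_isCompl h

theorem IsIndecSummandReps.exists_equiv (hΦ : IsIndecSummandReps Φ) {W : Type u} [AddCommGroup W]
    [Module R W] (hW : IsIndecomposable R W) (h : IsRetract R W M) :
    ∃ Z : Φ, Nonempty (W ≃ₗ[R] Z.1) := by
  obtain ⟨s, p, h⟩ := h
  have hs : Function.Injective s :=
    Function.LeftInverse.injective (g := p) fun x => LinearMap.congr_fun h x
  let e : W ≃ₗ[R] LinearMap.range s := LinearEquiv.ofInjective s hs
  obtain ⟨Z, ⟨hZ, ⟨e'⟩⟩, -⟩ := hΦ.existsUnique (LinearMap.range s) (hW.of_equiv e)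
    ⟨_, isCompl_range_ker_of_isUnit (b := p) (by rw [h]; exact isUnit_one)⟩
  exact ⟨⟨Z, hZ⟩, ⟨e ≪≫ₗ e'⟩⟩

theorem IsIndecSummandReps.eq_of_equiv (hΦ : IsIndecSummandReps Φ) {Y Z : Φ}
    (e : Y.1 ≃ₗ[R] Z.1) : Y = Z :=
  Subtype.ext ((hΦ.existsUnique Y.1 (hΦ.isSummand _ Y.2).1 (hΦ.isSummand _ Y.2).2).unique
    ⟨Y.2, ⟨LinearEquiv.refl R _⟩⟩ ⟨Z.2, ⟨e⟩⟩)

/-- The Krull–Schmidt theorem: a module of finite length has only finitely many indecomposable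
direct summands up to isomorphism. -/
theorem IsIndecSummandReps.finite [IsNoetherian R M] [IsArtinian R M]
    (hΦ : IsIndecSummandReps Φ) : Finite Φ := by
  classical
  obtain ⟨ι, _, W, hW, ⟨e⟩⟩ := exists_equiv_pi_indecomposable R M
  have key : ∀ Y : Φ, ∃ i, Nonempty (Y.1 ≃ₗ[R] W i) := by
    intro Y
    have hY := (hΦ.isSummand _ Y.2).1
    obtain ⟨s, p, hsp⟩ := hΦ.isRetract Y
    obtain ⟨i, -, s', p', h⟩ := hY.exists_isRetract Finset.univ (W := fun i => W i)
      (fun i => LinearMap.proj i ∘ₗ e.toLinearMap ∘ₗ s)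
      (fun i => p ∘ₗ e.symm.toLinearMap ∘ₗ LinearMap.single R (fun i => (W i : Type u)) i) (by
        ext y
        have h1 : ∑ i, Pi.single i (e (s y) i) = e (s y) := Finset.univ_sum_single _
        have h2 : p (e.symm (∑ i, Pi.single i (e (s y) i))) = y := by
          rw [h1, e.symm_apply_apply]
          exact LinearMap.congr_fun hsp y
        simpa [map_sum] using congrArg Subtype.val h2)
    have := hY.1
    exact ⟨i, ⟨LinearEquiv.ofBijective s'
      ((hW i).bijective_of_isUnit_comp (b := p') (h ▸ isUnit_one))⟩⟩
  choose i hi using key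
  exact Finite.of_injective i fun Y Z h => hΦ.eq_of_equiv
    ((hi Y).some ≪≫ₗ (h ▸ (hi Z).some.symm))

end Representatives

/-! ### The sequence of quotients of a module -/

section Sequence

variable {R : Type u} [Ring R]

/-- Rejects are functorial, so the section and the retraction both descend to the quotients. -/
theorem IsRetract.quotient_reject {M N : Type u} [AddCommGroup M] [Module R M] [AddCommGroup N]
    [Module R N] (h : IsRetract R M N) (Θ : Set (ModuleCat.{u} R)) :
    IsRetract R (M ⧸ reject M Θ) (N ⧸ reject N Θ) := by
  obtain ⟨s, p, h⟩ := h
  refine ⟨(reject M Θ).mapQ (reject N Θ) s fun x => map_mem_reject s,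
    (reject N Θ).mapQ (reject M Θ) p fun x => map_mem_reject p, ?_⟩
  ext x
  exact congrArg (Submodule.Quotient.mk (p := reject M Θ)) (LinearMap.congr_fun h x)

theorem isRetract_grSeq_grSum (X : Type u) [AddCommGroup X] [Module R X] (i : ℕ) :
    IsRetract R (grSeq R X i) (grSum R X) :=
  ⟨DirectSum.lof R ℕ (fun i => grSeq R X i) i, DirectSum.component R ℕ (fun i => grSeq R X i) i,
    LinearMap.ext fun x =>
    DirectSum.component.lof_self R (M := fun i => grSeq R X i) i x⟩

variable [IsArtinianRing R] (X : Type u) [AddCommGroup X] [Module R X] [Module.Finite R X]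

instance finite_grSeq (i : ℕ) : Module.Finite R (grSeq R X i) := by
  induction i with
  | zero => assumption
  | succ i ih =>
    exact Module.Finite.of_surjective (Submodule.mkQ (reject (grSeq R X i)
      (indecLT R (grMeasure R (grSeq R X i))))) (Submodule.mkQ_surjective _)

/-- As long as `X_i` is nonzero its reject is nonzero and the length drops; after reaching zero the
sequence stays there. -/
theorem exists_subsingleton_grSeq : ∃ n, ∀ i, n ≤ i → Subsingleton (grSeq R X i) := by
  have h : ∃ n, Subsingleton (grSeq R X n) := by
    by_contra! h
    refine not_strictAnti_of_wellFoundedLT (fun i => Module.length R (grSeq R X i))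
      (strictAnti_nat_of_succ_lt fun i => ?_)
    have := h i
    exact Submodule.length_quotient_lt _ (reject_grMeasure_ne_bot (grSeq R X i))
  obtain ⟨n, hn⟩ := h
  refine ⟨n, fun i hi => ?_⟩
  induction i, hi using Nat.le_induction with
  | base => exact hn
  | succ i _ ih =>
    exact (Submodule.mkQ_surjective (reject (grSeq R X i)
      (indecLT R (grMeasure R (grSeq R X i))))).subsingleton

/-- The identity of `grSum R X` is a finite sum of projections. -/
theorem exists_sum_component_grSum : ∃ n, ∀ x : grSum R X,
    ∑ i ∈ Finset.range n, DirectSum.lof R ℕ (fun i => grSeq R X i) i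
      (DirectSum.component R ℕ (fun i => grSeq R X i) i x) = x := by
  obtain ⟨n, hn⟩ := exists_subsingleton_grSeq (R := R) X
  refine ⟨n, fun x => DFinsupp.ext fun j => ?_⟩
  by_cases hj : n ≤ j
  · have := hn j hj
    exact Subsingleton.elim _ _
  · change DirectSum.component R ℕ (fun i => grSeq R X i) j _ =
      DirectSum.component R ℕ (fun i => grSeq R X i) j x
    rw [map_sum, Finset.sum_eq_single j]
    · rw [DirectSum.component.lof_self]
    · intro i _ hij
      rw [DirectSum.component.of, dif_neg hij]
    · intro h
      exact absurd (Finset.mem_range.2 (not_le.1 hj)) h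

instance finite_grSum : Module.Finite R (grSum R X) := by
  obtain ⟨n, hn⟩ := exists_sum_component_grSum (R := R) X
  refine Module.Finite.of_surjective (∑ i : Fin n,
    DirectSum.lof R ℕ (fun i => grSeq R X i) i ∘ₗ
      (LinearMap.proj i : (∀ i : Fin n, grSeq R X i) →ₗ[R] grSeq R X i)) fun x => ?_
  refine ⟨fun i => DirectSum.component R ℕ (fun i => grSeq R X i) i x, ?_⟩
  conv_rhs => rw [← hn x]
  simp [Finset.sum_range]

variable {X}

/-- An indecomposable direct summand of `grSum R X` is a direct summand of a term of the same
measure. -/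
theorem exists_isRetract_grSeq {Y : Type u} [AddCommGroup Y] [Module R Y]
    (hY : IsIndecomposable R Y) (h : IsRetract R Y (grSum R X)) :
    ∃ i, IsRetract R Y (grSeq R X i) ∧ grMeasure R (grSeq R X i) = grMeasure R Y := by
  have hfin := h.finite
  obtain ⟨n, hn⟩ := exists_sum_component_grSum (R := R) X
  obtain ⟨s, p, hsp⟩ := h
  obtain ⟨i, -, hi⟩ := hY.exists_isRetract (Finset.range n) (W := fun i => grSeq R X i)
    (fun i => DirectSum.component R ℕ (fun i => grSeq R X i) i ∘ₗ s)
    (fun i => p ∘ₗ DirectSum.lof R ℕ (fun i => grSeq R X i) i) (by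
      ext y
      have h2 := congrArg p (hn (s y))
      rw [map_sum] at h2
      rw [LinearMap.sum_apply]
      exact h2.trans (LinearMap.congr_fun hsp y))
  by_contra! hne
  -- While `μ(Y) < μ(X_j)`, the module `Y` belongs to the class that defines the reject, so its own
  -- reject vanishes and `Y` survives as a summand of `X_{j+1}`. Surviving forever contradicts the
  -- vanishing of the sequence.
  have hall : ∀ j, i ≤ j → IsRetract R Y (grSeq R X j) := by
    intro j hj
    induction j, hj using Nat.le_induction with
    | base => exact hi
    | succ j _ ih =>
      have hlt : grMeasure R Y < grMeasure R (grSeq R X j) :=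
        ih.grMeasure_le.lt_of_ne (hne j ih).symm
      have h0 : reject Y (indecLT R (grMeasure R (grSeq R X j))) = ⊥ :=
        reject_eq_bot_of_mem ⟨hfin, hY, hlt⟩
      exact (IsRetract.of_equiv (Submodule.quotEquivOfEqBot _ h0).symm).trans
        (ih.quotient_reject _)
  obtain ⟨m, hm⟩ := exists_subsingleton_grSeq (R := R) X
  have := hm (max i m) (le_max_right _ _)
  obtain ⟨s', p', hsp'⟩ := hall (max i m) (le_max_left _ _)
  have := hY.1
  obtain ⟨y, hy⟩ := exists_ne (0 : Y)
  refine hy ?_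
  rw [← LinearMap.id_apply (R := R) y, ← hsp', LinearMap.comp_apply,
    Subsingleton.elim (s' y) 0, map_zero]

/-- This is what the sequence is built for: `Y` is a summand of some `X_i` of the same measure, so
both rejects refer to the same class and the quotient is a summand of `X_{i+1}`. -/
theorem isRetract_quotient_reject {Y : Type u} [AddCommGroup Y] [Module R Y]
    (hY : IsIndecomposable R Y) (h : IsRetract R Y (grSum R X)) :
    IsRetract R (Y ⧸ reject Y (indecLT R (grMeasure R Y))) (grSum R X) := by
  obtain ⟨i, hi, he⟩ := exists_isRetract_grSeq hY h
  rw [← he]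
  exact (hi.quotient_reject _).trans (isRetract_grSeq_grSum X (i + 1))

/-- The quotient of `Y` by its reject is a direct sum of representatives of smaller measure. -/
theorem exists_pi_surjective_ker_eq_reject {Φ : Set (Submodule R (grSum R X))}
    (hΦ : IsIndecSummandReps Φ) (Y : Φ) :
    ∃ (ι : Type) (_ : Fintype ι) (Z : ι → Φ) (a : ∀ i, Y.1 →ₗ[R] (Z i).1),
      (∀ i, grMeasure R (Z i).1 < grMeasure R Y.1) ∧ Function.Surjective (LinearMap.pi a) ∧
      LinearMap.ker (LinearMap.pi a) = reject Y.1 (indecLT R (grMeasure R Y.1)) := by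
  have hY := (hΦ.isSummand _ Y.2).1
  set K := reject Y.1 (indecLT R (grMeasure R Y.1)) with hK
  have hret : IsRetract R (Y.1 ⧸ K) (grSum R X) := isRetract_quotient_reject hY (hΦ.isRetract Y)
  obtain ⟨ι, _, W, hW, ⟨e⟩⟩ := exists_equiv_pi_indecomposable R (Y.1 ⧸ K)
  have hWret : ∀ i, IsRetract R (W i) (Y.1 ⧸ K) := fun i => IsRetract.of_equiv_pi e i
  choose Z hZ using fun i => hΦ.exists_equiv (hW i) ((hWret i).trans hret)
  let E : (Y.1 ⧸ K) ≃ₗ[R] ∀ i, (Z i).1 := e ≪≫ₗ LinearEquiv.piCongrRight fun i => (hZ i).some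
  have hpi : LinearMap.pi (fun i => LinearMap.proj i ∘ₗ E.toLinearMap ∘ₗ K.mkQ) =
      E.toLinearMap ∘ₗ K.mkQ := rfl
  refine ⟨ι, inferInstance, Z, fun i => LinearMap.proj i ∘ₗ E.toLinearMap ∘ₗ K.mkQ, ?_, ?_, ?_⟩
  · intro i
    have := (hWret i).finite
    rw [← grMeasure_eq_of_equiv (hZ i).some]
    obtain ⟨s, p, h⟩ := hWret i
    -- Being embedded in `Y/K`, the summand is cogenerated by modules of measure below `μ(Y)`, so
    -- the main property applies.
    exact grMeasure_lt_of_reject_eq_bot (hW i) (reject_eq_bot_of_injective (f := s)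
      (Function.LeftInverse.injective (g := p) fun x => LinearMap.congr_fun h x)
      (reject_quotient_reject _))
  · rw [hpi]
    exact E.surjective.comp K.mkQ_surjective
  · rw [hpi, LinearEquiv.ker_comp, Submodule.ker_mkQ]

end Sequence

/-! ### Projective dimension of modules -/

section ProjectiveDimension

variable {Γ : Type u} [Ring Γ]

theorem hasProjectiveDimensionLE_of_equiv {M N : Type u} [AddCommGroup M] [Module Γ M]
    [AddCommGroup N] [Module Γ N] (e : M ≃ₗ[Γ] N) {n : ℕ}
    (h : HasProjectiveDimensionLE (ModuleCat.of Γ M) n) :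
    HasProjectiveDimensionLE (ModuleCat.of Γ N) n :=
  hasProjectiveDimensionLT_of_iso e.toModuleIso (n + 1)

theorem hasProjectiveDimensionLE_of_le {M : ModuleCat.{u} Γ} {m n : ℕ}
    (h : HasProjectiveDimensionLE M m) (hmn : m ≤ n) : HasProjectiveDimensionLE M n :=
  hasProjectiveDimensionLT_of_ge M (m + 1) (n + 1) (by omega)

theorem hasProjectiveDimensionLE_of_projective {M : Type u} [AddCommGroup M] [Module Γ M]
    (h : Module.Projective Γ M) (n : ℕ) : HasProjectiveDimensionLE (ModuleCat.of Γ M) n := by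
  have : Projective (ModuleCat.of Γ M) := (IsProjective.iff_projective M).1 h
  exact hasProjectiveDimensionLE_of_le (m := 0) inferInstance (Nat.zero_le n)

/-- The short exact sequence `0 → ker f → M → N → 0`. -/
theorem shortExact_ker {M N : Type u} [AddCommGroup M] [Module Γ M] [AddCommGroup N] [Module Γ N]
    {f : M →ₗ[Γ] N} (hf : Function.Surjective f) : f.shortComplexKer.ShortExact :=
  LinearMap.shortExact_shortComplexKer hf

theorem hasProjectiveDimensionLE_of_ker {M N : Type u} [AddCommGroup M] [Module Γ M]
    [AddCommGroup N] [Module Γ N] {f : M →ₗ[Γ] N} (hf : Function.Surjective f) {n : ℕ}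
    (h : HasProjectiveDimensionLE (ModuleCat.of Γ (LinearMap.ker f)) n)
    (h' : HasProjectiveDimensionLE (ModuleCat.of Γ N) n) :
    HasProjectiveDimensionLE (ModuleCat.of Γ M) n :=
  (shortExact_ker hf).hasProjectiveDimensionLT_X₂ (n + 1) h h'

theorem hasProjectiveDimensionLE_succ_of_ker {M N : Type u} [AddCommGroup M] [Module Γ M]
    [AddCommGroup N] [Module Γ N] {f : M →ₗ[Γ] N} (hf : Function.Surjective f) {n : ℕ}
    (h : HasProjectiveDimensionLE (ModuleCat.of Γ (LinearMap.ker f)) n)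
    (h' : HasProjectiveDimensionLE (ModuleCat.of Γ M) (n + 1)) :
    HasProjectiveDimensionLE (ModuleCat.of Γ N) (n + 1) :=
  (shortExact_ker hf).hasProjectiveDimensionLT_X₃ (n + 1) h h'

theorem hasProjectiveDimensionLE_ker {M N : Type u} [AddCommGroup M] [Module Γ M]
    [AddCommGroup N] [Module Γ N] {f : M →ₗ[Γ] N} (hf : Function.Surjective f) {n : ℕ}
    (h : HasProjectiveDimensionLE (ModuleCat.of Γ M) n)
    (h' : HasProjectiveDimensionLE (ModuleCat.of Γ N) (n + 1)) :
    HasProjectiveDimensionLE (ModuleCat.of Γ (LinearMap.ker f)) n :=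
  (shortExact_ker hf).hasProjectiveDimensionLT_X₁ (n + 1) h h'

theorem hasProjectiveDimensionLE_succ_of_exact {K M N : Type u} [AddCommGroup K] [Module Γ K]
    [AddCommGroup M] [Module Γ M] [AddCommGroup N] [Module Γ N] {j : K →ₗ[Γ] M} {f : M →ₗ[Γ] N}
    (hj : Function.Injective j) (hf : Function.Surjective f)
    (hjf : LinearMap.range j = LinearMap.ker f) {n : ℕ}
    (h : HasProjectiveDimensionLE (ModuleCat.of Γ K) n)
    (h' : HasProjectiveDimensionLE (ModuleCat.of Γ M) (n + 1)) :
    HasProjectiveDimensionLE (ModuleCat.of Γ N) (n + 1) :=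
  hasProjectiveDimensionLE_succ_of_ker hf (hasProjectiveDimensionLE_of_equiv
    ((LinearEquiv.ofInjective j hj).trans (LinearEquiv.ofEq _ _ hjf)) h) h'

theorem hasProjectiveDimensionLE_succ_dfinsupp_of_exact {ι : Type u} {K F M : ι → Type u}
    [∀ i, AddCommGroup (K i)] [∀ i, Module Γ (K i)] [∀ i, AddCommGroup (F i)]
    [∀ i, Module Γ (F i)] [∀ i, AddCommGroup (M i)] [∀ i, Module Γ (M i)]
    {j : ∀ i, K i →ₗ[Γ] F i} {g : ∀ i, F i →ₗ[Γ] M i} (hj : ∀ i, Function.Injective (j i))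
    (hg : ∀ i, Function.Surjective (g i)) (hjg : ∀ i, LinearMap.range (j i) = LinearMap.ker (g i))
    {n : ℕ} (h : HasProjectiveDimensionLE (ModuleCat.of Γ (Π₀ i, K i)) n)
    (h' : HasProjectiveDimensionLE (ModuleCat.of Γ (Π₀ i, F i)) (n + 1)) :
    HasProjectiveDimensionLE (ModuleCat.of Γ (Π₀ i, M i)) (n + 1) := by
  refine hasProjectiveDimensionLE_succ_of_exact (j := DFinsupp.mapRange.linearMap j)
    (f := DFinsupp.mapRange.linearMap g) ?_ ?_ ?_ h h'
  · exact (DFinsupp.mapRange_injective (fun i => j i) fun i => map_zero (j i)).2 hj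
  · exact (DFinsupp.mapRange_surjective (fun i => g i) fun i => map_zero (g i)).2 hg
  · refine (DFinsupp.range_mapRangeLinearMap j).trans
      (Eq.trans ?_ (DFinsupp.ker_mapRangeLinearMap g).symm)
    simp [hjg]

/-- Direct sums do not increase the projective dimension. -/
theorem hasProjectiveDimensionLE_dfinsupp {ι : Type u} (M : ι → Type u)
    [∀ i, AddCommGroup (M i)] [∀ i, Module Γ (M i)] {n : ℕ}
    (h : ∀ i, HasProjectiveDimensionLE (ModuleCat.of Γ (M i)) n) :
    HasProjectiveDimensionLE (ModuleCat.of Γ (Π₀ i, M i)) n := by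
  induction n generalizing M with
  | zero =>
    have : ∀ i, Module.Projective Γ (M i) := fun i =>
      (IsProjective.iff_projective (M i)).2
        ((projective_iff_hasProjectiveDimensionLE_zero _).2 (h i))
    exact hasProjectiveDimensionLE_of_projective inferInstance 0
  | succ n ih =>
    have hF' : ∀ i, Module.Projective Γ (M i →₀ Γ) := fun i => inferInstance
    have hF : Module.Projective Γ (Π₀ i, (M i →₀ Γ)) := inferInstance
    let g : ∀ i, (M i →₀ Γ) →ₗ[Γ] M i := fun i => Finsupp.linearCombination Γ id
    have hg : ∀ i, Function.Surjective (g i) := fun i =>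
      Finsupp.linearCombination_id_surjective Γ (M i)
    have hK : ∀ i, HasProjectiveDimensionLE (ModuleCat.of Γ (LinearMap.ker (g i))) n := fun i =>
      hasProjectiveDimensionLE_ker (hg i) (hasProjectiveDimensionLE_of_projective (hF' i) n) (h i)
    exact hasProjectiveDimensionLE_succ_dfinsupp_of_exact (F := fun i => M i →₀ Γ)
      (j := fun i => (LinearMap.ker (g i)).subtype)
      (fun i => Submodule.subtype_injective _) hg (fun i => Submodule.range_subtype _) (ih _ hK)
      (hasProjectiveDimensionLE_of_projective hF _)

variable {Φ : Type u} {P : Φ → ModuleCat.{u} Γ}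

/-- Over a semiprimary ring, the projective dimension of a module is bounded by that of the
simple modules `top (P Y)` for which there is a nonzero homomorphism from `P Y`. -/
theorem hasProjectiveDimensionLE_of_tops [IsSemiprimaryRing Γ] (hP : LabelsSimples P) {n : ℕ}
    (M : Type u) [AddCommGroup M] [Module Γ M]
    (h : ∀ (Y : Φ) (f : P Y →ₗ[Γ] M), f ≠ 0 →
      HasProjectiveDimensionLE (ModuleCat.of Γ (top Γ (P Y))) n) :
    HasProjectiveDimensionLE (ModuleCat.of Γ M) n := by
  refine IsSemiprimaryRing.induction ℤ Γ M (P := fun M _ _ _ =>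
    (∀ (Y : Φ) (f : P Y →ₗ[Γ] M), f ≠ 0 →
      HasProjectiveDimensionLE (ModuleCat.of Γ (top Γ (P Y))) n) →
    HasProjectiveDimensionLE (ModuleCat.of Γ M) n) ?_ ?_ h
  · intro M _ _ _ _ _ _ h
    obtain ⟨s, e, -, hs⟩ := IsSemisimpleModule.exists_linearEquiv_dfinsupp Γ M
    refine hasProjectiveDimensionLE_of_equiv e.symm
      (hasProjectiveDimensionLE_dfinsupp _ fun S => ?_)
    obtain ⟨Y, ⟨e'⟩⟩ := hP.exists_top_equiv (ModuleCat.of Γ S.1) (hs S)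
    refine hasProjectiveDimensionLE_of_equiv e'.symm (h Y
      (S.1.subtype ∘ₗ e'.symm.toLinearMap ∘ₗ Submodule.mkQ (Module.jacobson Γ (P Y))) fun h0 => ?_)
    have := IsSimpleModule.nontrivial Γ S.1
    obtain ⟨x, hx⟩ := exists_ne (0 : S.1)
    obtain ⟨y, hy⟩ := Submodule.mkQ_surjective _ (e' x)
    refine hx (Subtype.ext ?_)
    have := LinearMap.congr_fun h0 y
    rwa [LinearMap.comp_apply, LinearMap.comp_apply, hy, LinearEquiv.coe_coe,
      e'.symm_apply_apply] at this
  -- The hypothesis passes to both ends of an extension: maps from `P Y` into `N` extend to maps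
  -- into `M`, and maps into `M/N` lift because `P Y` is projective.
  · intro M _ _ _ _ N hN hQ h
    refine hasProjectiveDimensionLE_of_ker N.mkQ_surjective
      (hasProjectiveDimensionLE_of_equiv (LinearEquiv.ofEq _ _ N.ker_mkQ.symm) (hN fun Y f hf =>
        h Y (N.subtype ∘ₗ f) fun h0 => hf ?_)) (hQ fun Y f hf => ?_)
    · ext x
      exact LinearMap.congr_fun h0 x
    · have := hP.projective Y
      obtain ⟨g, hg⟩ := Module.projective_lifting_property N.mkQ f N.mkQ_surjective
      refine h Y g fun h0 => hf ?_
      rw [← hg, h0, LinearMap.comp_zero]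

end ProjectiveDimension

/-! ### A criterion for strongly quasihereditary rings -/

section Filtration

variable {Γ : Type u} [Ring Γ] {Φ : Type u} (r : Φ → Φ → Prop) (P : Φ → ModuleCat.{u} Γ)
  (S : Set Φ)

/-- The subquotient `V / U` is a standard module with label in `S`. -/
def FiltrationStep {M : Type u} [AddCommGroup M] [Module Γ M] (U V : Submodule Γ M) : Prop :=
  U ≤ V ∧ ∃ Z ∈ S, Nonempty ((V ⧸ U.submoduleOf V) ≃ₗ[Γ] Standard r P Z)

variable {r P S}

theorem hasStandardFiltration_of_reflTransGen {M : Type u} [AddCommGroup M] [Module Γ M]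
    {U : Submodule Γ M} (h : Relation.ReflTransGen (FiltrationStep r P S) ⊥ U) :
    HasStandardFiltration r P U S := by
  induction h with
  | refl => exact ⟨0, fun _ => ⊥, rfl, rfl, fun i hi => absurd hi (Nat.not_lt_zero i)⟩
  | @tail U V _ hUV ih =>
    obtain ⟨n, F, h0, hn, hF⟩ := ih
    refine ⟨n + 1, fun i => if i ≤ n then F i else V, by simpa using h0, by simp, fun i hi => ?_⟩
    rcases Nat.lt_succ_iff_lt_or_eq.1 hi with hi | rfl
    · have h1 : (fun i => if i ≤ n then F i else V) i = F i := if_pos hi.le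
      have h2 : (fun i => if i ≤ n then F i else V) (i + 1) = F (i + 1) := if_pos hi
      rw [h1, h2]
      exact hF i hi
    · have h1 : (fun j => if j ≤ i then F j else V) i = U := (if_pos le_rfl).trans hn
      have h2 : (fun j => if j ≤ i then F j else V) (i + 1) = V := if_neg (by omega)
      rw [h1, h2]
      exact hUV

/-- The composite `V' → V → V/U` is onto with kernel `U'`, so the two subquotients agree. This
transports steps along embeddings and coordinate projections. -/
theorem FiltrationStep.of_surjective {M N : Type u} [AddCommGroup M] [Module Γ M] [AddCommGroup N]
    [Module Γ N] {U V : Submodule Γ M} {U' V' : Submodule Γ N} (h : FiltrationStep r P S U V)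
    (hle : U' ≤ V') (q : V' →ₗ[Γ] V) (hq : Function.Surjective q)
    (hU : ∀ x, (q x : M) ∈ U ↔ (x : N) ∈ U') : FiltrationStep r P S U' V' := by
  obtain ⟨-, Z, hZ, ⟨e⟩⟩ := h
  refine ⟨hle, Z, hZ, ⟨?_⟩⟩
  let e' := ((U.submoduleOf V).mkQ ∘ₗ q).quotKerEquivOfSurjective
    ((Submodule.mkQ_surjective _).comp hq)
  refine (Submodule.quotEquivOfEq _ _ ?_).trans (e'.trans e)
  ext x
  rw [LinearMap.ker_comp, Submodule.ker_mkQ, Submodule.mem_comap]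
  exact (hU x).symm

theorem FiltrationStep.map {M N : Type u} [AddCommGroup M] [Module Γ M] [AddCommGroup N]
    [Module Γ N] {f : M →ₗ[Γ] N} (hf : Function.Injective f) {U V : Submodule Γ M}
    (h : FiltrationStep r P S U V) : FiltrationStep r P S (U.map f) (V.map f) := by
  refine h.of_surjective (Submodule.map_mono h.1) (V.equivMapOfInjective f hf).symm.toLinearMap
    (LinearEquiv.surjective _) fun x => ?_
  obtain ⟨y, rfl⟩ := (V.equivMapOfInjective f hf).surjective x
  simp [hf.eq_iff]

/-- A finite product of filtered modules is filtered. -/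
theorem reflTransGen_filtrationStep_pi {ι : Type} [Fintype ι] {N : ι → Type u}
    [∀ i, AddCommGroup (N i)] [∀ i, Module Γ (N i)]
    (h : ∀ i, Relation.ReflTransGen (FiltrationStep r P S) (⊥ : Submodule Γ (N i)) ⊤) :
    Relation.ReflTransGen (FiltrationStep r P S) (⊥ : Submodule Γ (∀ i, N i)) ⊤ := by
  classical
  -- `A t` consists of the vectors supported on `t`. Below, `B U` interpolates between `A t` and `A
  -- (insert i t)` by requiring the `i`-th coordinate to lie in `U`, so a filtration of `N i` fills
  -- the gap.
  let A : Finset ι → Submodule Γ (∀ i, N i) := fun t => Submodule.pi {i | i ∉ t} fun _ => ⊥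
  have hA : ∀ t, Relation.ReflTransGen (FiltrationStep r P S) (A ∅) (A t) := by
    intro t
    induction t using Finset.induction_on with
    | empty => exact .refl
    | insert i t hi ih =>
      refine ih.trans ?_
      let B : Submodule Γ (N i) → Submodule Γ (∀ i, N i) := fun U =>
        A (insert i t) ⊓ U.comap (LinearMap.proj i)
      have h0 : B ⊥ = A t := by
        ext x
        simp only [B, A, Submodule.mem_inf, Submodule.mem_pi, Set.mem_ofPred_eq, Finset.mem_insert,
          Submodule.mem_bot, Submodule.mem_comap, LinearMap.proj_apply, not_or]
        constructor
        · rintro ⟨h1, h2⟩ j hj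
          by_cases hji : j = i
          · rw [hji, h2]
          · exact h1 j ⟨hji, hj⟩
        · exact fun h => ⟨fun j hj => h j hj.2, h i hi⟩
      have h1 : B ⊤ = A (insert i t) := by simp [B]
      rw [← h0, ← h1]
      refine Relation.ReflTransGen.lift B (fun U V hUV => ?_) _ _ (h i)
      refine hUV.of_surjective (inf_le_inf_left _ (Submodule.comap_mono hUV.1))
        (((LinearMap.proj i : (∀ i, N i) →ₗ[Γ] N i) ∘ₗ (B V).subtype).codRestrict V
          fun x => x.2.2) (fun v => ?_) fun x => ?_
      · refine ⟨⟨Pi.single i v.1, fun j hj => ?_, ?_⟩, ?_⟩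
        · rw [Pi.single_eq_of_ne]
          · exact Submodule.zero_mem _
          · rintro rfl
            exact hj (Finset.mem_insert_self _ _)
        · rw [SetLike.mem_coe, Submodule.mem_comap, LinearMap.proj_apply, Pi.single_eq_same]
          exact v.2
        · exact Subtype.ext (Pi.single_eq_same (M := N) i v.1)
      · exact ⟨fun h => ⟨x.2.1, h⟩, fun h => h.2⟩
  have h0 : A ∅ = ⊥ := by
    ext x
    simp [A, funext_iff]
  have h1 : A Finset.univ = ⊤ := by
    ext x
    simp [A]
  rw [← h0, ← h1]
  exact hA _

end Filtration

/-! ### From resolutions of standard modules to the quasihereditary axioms -/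

section Criterion

variable {Γ : Type u} [Ring Γ] {Φ : Type u} {r : Φ → Φ → Prop} {P : Φ → ModuleCat.{u} Γ}

/-- The kernels `U_Y` are direct sums of modules `P Z` with `Z` larger than `Y`. -/
def HasStdResolutions (r : Φ → Φ → Prop) (P : Φ → ModuleCat.{u} Γ) : Prop :=
  ∀ Y, ∃ (ι : Type) (_ : Fintype ι) (Z : ι → Φ) (ψ : (∀ i, P (Z i)) →ₗ[Γ] P Y),
    (∀ i, r Y (Z i) ∧ Z i ≠ Y) ∧ Function.Injective ψ ∧ LinearMap.range ψ = stdKernel r P Y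

theorem wellFounded_of_isPartialOrder [Finite Φ] (hr : IsPartialOrder Φ r) :
    WellFounded fun Y Z => r Y Z ∧ Y ≠ Z := by
  have : IsTrans Φ fun Y Z => r Y Z ∧ Y ≠ Z := ⟨fun A B C h h' =>
    ⟨hr.trans _ _ _ h.1 h'.1, fun he => h.2 (hr.antisymm _ _ h.1 (he ▸ h'.1))⟩⟩
  have : Std.Irrefl fun Y Z : Φ => r Y Z ∧ Y ≠ Z := ⟨fun A h => h.2 rfl⟩
  exact Finite.wellFounded_of_trans_of_irrefl _

theorem wellFounded_of_isPartialOrder' [Finite Φ] (hr : IsPartialOrder Φ r) :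
    WellFounded fun Z Y => r Y Z ∧ Z ≠ Y := by
  have : IsTrans Φ fun Z Y => r Y Z ∧ Z ≠ Y := ⟨fun A B C h h' =>
    ⟨hr.trans _ _ _ h'.1 h.1, fun he => h.2 (hr.antisymm _ _ (he ▸ h'.1) h.1)⟩⟩
  have : Std.Irrefl fun Z Y : Φ => r Y Z ∧ Z ≠ Y := ⟨fun A h => h.2 rfl⟩
  exact Finite.wellFounded_of_trans_of_irrefl _

/-- Induction from the maximal labels down: `U_Y` is a product of modules `P_Z` with `Z ▷ Y`, and
each `P_Z` is filtered by the filtration of `U_Z` with `Δ_Z` on top. -/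
theorem HasStdResolutions.reflTransGen_stdKernel [Finite Φ] (hr : IsPartialOrder Φ r)
    (h : HasStdResolutions r P) (Y : Φ) :
    Relation.ReflTransGen (FiltrationStep r P {Z | r Y Z ∧ Z ≠ Y}) ⊥ (stdKernel r P Y) := by
  induction Y using (wellFounded_of_isPartialOrder' hr).induction with
  | h Y ih =>
  obtain ⟨ι, _, Z, ψ, hZ, hψ, hrange⟩ := h Y
  have htop : ∀ i, Relation.ReflTransGen (FiltrationStep r P {Z | r Y Z ∧ Z ≠ Y})
      (⊥ : Submodule Γ (P (Z i))) ⊤ := by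
    intro i
    refine Relation.ReflTransGen.tail
      (Relation.ReflTransGen.mono (fun U V hUV => ?_) _ _ (ih (Z i) (hZ i)))
      ⟨le_top, Z i, hZ i, ⟨?_⟩⟩
    · obtain ⟨hle, T, hT, e⟩ := hUV
      exact ⟨hle, T, ⟨hr.trans _ _ _ (hZ i).1 hT.1, fun he => (hZ i).2
        (hr.antisymm _ _ (he ▸ hT.1) (hZ i).1)⟩, e⟩
    · refine Submodule.Quotient.equiv _ _ Submodule.topEquiv ?_
      ext x
      simp [Submodule.submoduleOf]
  have : Relation.ReflTransGen _ (Submodule.map ψ ⊥) (Submodule.map ψ ⊤) :=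
    Relation.ReflTransGen.lift (Submodule.map ψ) (fun U V => FiltrationStep.map hψ) _ _
    (reflTransGen_filtrationStep_pi htop)
  rwa [Submodule.map_bot, Submodule.map_top, hrange] at this

/-- By projectivity, `f` lifts to an endomorphism of `P Y`, which is onto or becomes zero modulo
`U_Y`. -/
theorem surjective_of_ne_zero_standard (hP : LabelsSimples P)
    (hend : ∀ Y (f : P Y →ₗ[Γ] P Y), Function.Surjective f ∨
      LinearMap.range f ≤ stdKernel r P Y) (Y : Φ) (f : P Y →ₗ[Γ] Standard r P Y) (hf : f ≠ 0) :
    Function.Surjective f := by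
  have := hP.projective Y
  obtain ⟨g, rfl⟩ := Module.projective_lifting_property (stdKernel r P Y).mkQ f
    (Submodule.mkQ_surjective _)
  rcases hend Y g with h | h
  · exact (Submodule.mkQ_surjective _).comp h
  · refine absurd (LinearMap.ext fun x => ?_) hf
    exact (Submodule.Quotient.mk_eq_zero _).2 (h ⟨x, rfl⟩)

theorem HasStdResolutions.hasProjectiveDimensionLE_standard (hP : LabelsSimples P)
    (h : HasStdResolutions r P) (Y : Φ) :
    HasProjectiveDimensionLE (ModuleCat.of Γ (Standard r P Y)) 1 := by
  obtain ⟨ι, _, Z, ψ, hZ, hψ, hrange⟩ := h Y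
  classical
  have : ∀ i, Module.Projective Γ (P (Z i)) := fun i => hP.projective _
  have hpi : Module.Projective Γ (∀ i, P (Z i)) :=
    Module.Projective.of_equiv' (DirectSum.linearEquivFunOnFintype Γ ι fun i => P (Z i))
  refine hasProjectiveDimensionLE_succ_of_exact hψ (Submodule.mkQ_surjective _)
    (hrange.trans (Submodule.ker_mkQ _).symm)
    (hasProjectiveDimensionLE_of_projective hpi 0)
    (hasProjectiveDimensionLE_of_projective (hP.projective Y) 1)

theorem isLeftStronglyQuasihereditary_of_hasStdResolutions [Finite Φ] (hΓ : IsSemiprimaryRing Γ)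
    (hr : IsPartialOrder Φ r) (hP : LabelsSimples P) (h : HasStdResolutions r P)
    (hend : ∀ Y (f : P Y →ₗ[Γ] P Y), Function.Surjective f ∨
      LinearMap.range f ≤ stdKernel r P Y) :
    IsLeftStronglyQuasihereditary r P where
  semiprimary := hΓ
  partialOrder := hr
  labels := hP
  filtration Y := hasStandardFiltration_of_reflTransGen (h.reflTransGen_stdKernel hr Y)
  surjective := surjective_of_ne_zero_standard hP hend
  projectiveDimension_le := h.hasProjectiveDimensionLE_standard hP

theorem exists_forall_of_mono [Finite Φ] {p : Φ → ℕ → Prop}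
    (hp : ∀ Y m n, m ≤ n → p Y m → p Y n) (h : ∀ Y, ∃ n, p Y n) : ∃ n, ∀ Y, p Y n := by
  choose f hf using h
  obtain ⟨n, hn⟩ := (Set.finite_range f).bddAbove
  exact ⟨n, fun Y => hp Y _ _ (hn ⟨Y, rfl⟩) (hf Y)⟩

/-- A left strongly quasihereditary ring with finitely many simple modules has finite global
dimension. -/
theorem IsLeftStronglyQuasihereditary.hasFiniteGlobalDimension [Finite Φ]
    (h : IsLeftStronglyQuasihereditary r P)
    (hU : ∀ Y, stdKernel r P Y ≤ Module.jacobson Γ (P Y)) : HasFiniteGlobalDimension Γ := by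
  have hP := h.labels
  have := h.semiprimary
  -- Induction from the minimal labels up, through the kernel of `Δ_Y → top P_Y`: only `P Z` with
  -- `Z` strictly below `Y` can map nontrivially to it.
  have key : ∀ Y, ∃ n, HasProjectiveDimensionLE (ModuleCat.of Γ (top Γ (P Y))) n := by
    intro Y
    induction Y using (wellFounded_of_isPartialOrder h.partialOrder).induction with
    | h Y ih =>
    obtain ⟨n, hn⟩ := exists_forall_of_mono (Φ := Φ) (p := fun Z n => r Z Y ∧ Z ≠ Y →
      HasProjectiveDimensionLE (ModuleCat.of Γ (top Γ (P Z))) n)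
      (fun Z m n hmn hm hZ => hasProjectiveDimensionLE_of_le (hm hZ) hmn) (fun Z => by
        by_cases hZ : r Z Y ∧ Z ≠ Y
        · exact (ih Z hZ).imp fun n hn _ => hn
        · exact ⟨0, fun h => absurd h hZ⟩)
    let q : Standard r P Y →ₗ[Γ] top Γ (P Y) := Submodule.factor (hU Y)
    have hq : Function.Surjective q := Submodule.factor_surjective (hU Y)
    refine ⟨n + 1, hasProjectiveDimensionLE_succ_of_ker hq ?_
      (hasProjectiveDimensionLE_of_le (h.projectiveDimension_le Y) (by omega))⟩
    refine hasProjectiveDimensionLE_of_tops hP _ fun Z f hf => hn Z ?_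
    have hf' : (LinearMap.ker q).subtype ∘ₗ f ≠ 0 := fun h0 => hf (by
      ext x
      exact LinearMap.congr_fun h0 x)
    constructor
    -- A map from `P Z` to `Δ_Y` lifts to `P Y`; for `Z ⋬ Y` the lift lands in `U_Y`, so the map is
    -- zero.
    · by_contra hZ
      have := hP.projective Z
      obtain ⟨g, hg⟩ := Module.projective_lifting_property (stdKernel r P Y).mkQ
        ((LinearMap.ker q).subtype ∘ₗ f) (Submodule.mkQ_surjective _)
      refine hf' ?_
      rw [← hg]
      ext x
      refine (Submodule.Quotient.mk_eq_zero _).2 ?_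
      exact (le_iSup₂_of_le Z hZ (le_iSup_of_le g le_rfl) :
        LinearMap.range g ≤ stdKernel r P Y) ⟨x, rfl⟩
    -- For `Z = Y` the nonzero map would be onto `Δ_Y`, yet it lands in the kernel of the surjection
    -- onto the nonzero top.
    · rintro rfl
      have hs := hq.comp (h.surjective Z _ hf')
      have := hP.isSimple_top Z
      have := IsSimpleModule.nontrivial Γ (top Γ (P Z))
      obtain ⟨x, hx⟩ := exists_ne (0 : top Γ (P Z))
      obtain ⟨y, rfl⟩ := hs x
      exact hx (f y).2
  obtain ⟨n, hn⟩ := exists_forall_of_mono (Φ := Φ)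
    (p := fun Z n => HasProjectiveDimensionLE (ModuleCat.of Γ (top Γ (P Z))) n)
    (fun Z m n hmn hm => hasProjectiveDimensionLE_of_le hm hmn) key
  exact ⟨n, fun M => hasProjectiveDimensionLE_of_tops hP M fun Y _ _ => hn Y⟩

end Criterion

/-! ### Projective modules over an endomorphism ring -/

section HomModules

variable {R : Type*} [Ring R] {M Y Z : Type*} [AddCommGroup M] [Module R M] [AddCommGroup Y]
  [Module R Y] [AddCommGroup Z] [Module R Z]

/-- Precomposition with `a`, as a homomorphism of modules over `End(M)`. -/
def precomp (M : Type*) [AddCommGroup M] [Module R M] (a : Y →ₗ[R] Z) :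
    (Z →ₗ[R] M) →ₗ[Module.End R M] (Y →ₗ[R] M) where
  toFun g := g ∘ₗ a
  map_add' _ _ := rfl
  map_smul' _ _ := rfl

@[simp] theorem precomp_apply (a : Y →ₗ[R] Z) (g : Z →ₗ[R] M) : precomp M a g = g ∘ₗ a := rfl

variable {s : Y →ₗ[R] M} {p : M →ₗ[R] Y}

/-- Yoneda's lemma for direct summands of `M`. -/
theorem hom_apply_eq_smul (h : p ∘ₗ s = LinearMap.id) {Q : Type*} [AddCommGroup Q]
    [Module (Module.End R M) Q] (φ : (Y →ₗ[R] M) →ₗ[Module.End R M] Q) (g : Y →ₗ[R] M) :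
    φ g = (show Module.End R M from g ∘ₗ p) • φ s := by
  rw [← map_smul]
  congr 1
  change g = (g ∘ₗ p) ∘ₗ s
  rw [LinearMap.comp_assoc, h, LinearMap.comp_id]

/-- By Yoneda, `φ` is determined by `φ s`. Questions about maps `P_Y → P_Z` thus become questions
about maps `Z → Y`. -/
theorem hom_eq_precomp (h : p ∘ₗ s = LinearMap.id)
    (φ : (Y →ₗ[R] M) →ₗ[Module.End R M] (Z →ₗ[R] M)) : φ = precomp M (p ∘ₗ φ s) :=
  LinearMap.ext fun g => hom_apply_eq_smul h φ g

/-- Precomposition with `p` and `s` exhibits `Hom(Y, M)` as a direct summand of `End(M)`. -/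
theorem projective_hom (h : IsRetract R Y M) :
    Module.Projective (Module.End R M) (Y →ₗ[R] M) := by
  obtain ⟨s, p, h⟩ := h
  let i : (Y →ₗ[R] M) →ₗ[Module.End R M] Module.End R M := precomp M p
  let q : Module.End R M →ₗ[Module.End R M] (Y →ₗ[R] M) := precomp M s
  refine Module.Projective.of_split i q (LinearMap.ext fun g => ?_)
  change (g ∘ₗ p) ∘ₗ s = g
  rw [LinearMap.comp_assoc, h, LinearMap.comp_id]

/-- The radical of `Hom(Y, M)`: the homomorphisms that are not split monomorphisms. -/
def radHom (Y M : Type*) [AddCommGroup Y] [Module R Y] [AddCommGroup M] [Module R M]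
    [IsLocalRing (Module.End R Y)] : Submodule (Module.End R M) (Y →ₗ[R] M) where
  carrier := {g | ∀ b : M →ₗ[R] Y, ¬ IsUnit (show Module.End R Y from b ∘ₗ g)}
  zero_mem' b h := by
    rw [LinearMap.comp_zero] at h
    exact not_isUnit_zero h
  add_mem' {f g} hf hg b h := by
    rw [LinearMap.comp_add] at h
    exact (isUnit_or_isUnit_of_isUnit_add' h).elim (hf b) (hg b)
  smul_mem' c g hg b h := hg (b ∘ₗ c) h

variable [IsLocalRing (Module.End R Y)]

theorem mem_radHom {g : Y →ₗ[R] M} :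
    g ∈ radHom Y M ↔ ∀ b : M →ₗ[R] Y, ¬ IsUnit (show Module.End R Y from b ∘ₗ g) := Iff.rfl

/-- A split monomorphism `g` generates `Hom(Y, M)`, because every `f` factors through it. Hence
`radHom` is the unique maximal submodule when `Y` is a retract of `M`. -/
theorem le_radHom_of_ne_top {N : Submodule (Module.End R M) (Y →ₗ[R] M)} (hN : N ≠ ⊤) :
    N ≤ radHom Y M := by
  intro g hg b hu
  refine hN (eq_top_iff.2 fun f _ => ?_)
  obtain ⟨v, -, hv⟩ := isUnit_iff_exists.1 hu
  have : f = (show Module.End R M from f ∘ₗ v ∘ₗ b) • g := by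
    change f = (f ∘ₗ v ∘ₗ b) ∘ₗ g
    rw [LinearMap.comp_assoc, LinearMap.comp_assoc]
    change f = f ∘ₗ (v * (show Module.End R Y from b ∘ₗ g))
    rw [hv]
    rfl
  rw [this]
  exact N.smul_mem _ hg

theorem notMem_radHom (h : p ∘ₗ s = LinearMap.id) : s ∉ radHom Y M := fun hs =>
  hs p (h ▸ isUnit_one)

theorem isCoatom_radHom (h : IsRetract R Y M) :
    IsCoatom (radHom Y M : Submodule (Module.End R M) (Y →ₗ[R] M)) := by
  obtain ⟨s, p, h⟩ := h
  refine ⟨fun ht => notMem_radHom h (ht ▸ Submodule.mem_top), fun N hN => ?_⟩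
  by_contra hne
  exact hN.not_ge (le_radHom_of_ne_top hne)

theorem eq_radHom_of_isCoatom (h : IsRetract R Y M)
    {N : Submodule (Module.End R M) (Y →ₗ[R] M)} (hN : IsCoatom N) : N = radHom Y M := by
  by_contra hne
  exact (isCoatom_radHom h).1 (hN.2 _ ((le_radHom_of_ne_top hN.1).lt_of_ne hne))

theorem jacobson_hom (h : IsRetract R Y M) :
    Module.jacobson (Module.End R M) (Y →ₗ[R] M) = radHom Y M := by
  refine le_antisymm (sInf_le (isCoatom_radHom h)) (le_sInf fun N hN => ?_)
  exact (eq_radHom_of_isCoatom h hN).ge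

theorem isSimpleModule_top_hom (h : IsRetract R Y M) :
    IsSimpleModule (Module.End R M) (top (Module.End R M) (Y →ₗ[R] M)) := by
  rw [isSimpleModule_iff_isCoatom, jacobson_hom h]
  exact isCoatom_radHom h

theorem isIndecomposable_hom (h : IsRetract R Y M) :
    IsIndecomposable (Module.End R M) (Y →ₗ[R] M) := by
  have hc := isCoatom_radHom h
  refine ⟨?_, fun N N' hN => ?_⟩
  · obtain ⟨s, p, hsp⟩ := h
    exact ⟨s, 0, fun h0 => notMem_radHom hsp (h0 ▸ Submodule.zero_mem _)⟩
  · by_contra! hne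
    have h1 : N ≠ ⊤ := fun ht => hne.2 (by simpa [ht] using hN.inf_eq_bot)
    have h2 : N' ≠ ⊤ := fun ht => hne.1 (by simpa [ht] using hN.inf_eq_bot)
    refine hc.1 (top_le_iff.1 ?_)
    rw [← hN.sup_eq_top]
    exact sup_le (le_radHom_of_ne_top h1) (le_radHom_of_ne_top h2)

/-- A simple module with a nonzero homomorphism from `Hom(Y, M)` is its top. -/
theorem nonempty_equiv_top_of_ne_zero (h : IsRetract R Y M) {S : Type*} [AddCommGroup S]
    [Module (Module.End R M) S] [IsSimpleModule (Module.End R M) S]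
    {φ : (Y →ₗ[R] M) →ₗ[Module.End R M] S} (hφ : φ ≠ 0) :
    Nonempty (S ≃ₗ[Module.End R M] top (Module.End R M) (Y →ₗ[R] M)) := by
  have hs := φ.surjective_of_ne_zero hφ
  have hk : LinearMap.ker φ = radHom Y M := by
    refine eq_radHom_of_isCoatom h ?_
    rw [← isSimpleModule_iff_isCoatom]
    exact IsSimpleModule.congr (φ.quotKerEquivOfSurjective hs)
  exact ⟨(φ.quotKerEquivOfSurjective hs).symm.trans
    (Submodule.quotEquivOfEq _ _ (hk.trans (jacobson_hom h).symm))⟩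

end HomModules

/-! ### Simple modules over the endomorphism ring -/

section Labels

variable {R : Type u} [Ring R] {M : Type u} [AddCommGroup M] [Module R M] [IsNoetherian R M]
  [IsArtinian R M] {Φ : Set (Submodule R M)}

theorem IsIndecSummandReps.isLocalRing (hΦ : IsIndecSummandReps Φ) (Y : Φ) :
    IsLocalRing (Module.End R Y.1) :=
  (hΦ.isSummand _ Y.2).1.isLocalRing_end

/-- The isomorphism of tops lifts to a map `P_Y → P_Z`, which is precomposition with some `Z → Y`.
Since `f s` avoids the radical, this map is a split monomorphism, hence bijective because `Y` is
indecomposable. -/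
theorem IsIndecSummandReps.eq_of_top_equiv (hΦ : IsIndecSummandReps Φ) {Y Z : Φ}
    (e : top (Module.End R M) (Y.1 →ₗ[R] M) ≃ₗ[Module.End R M]
      top (Module.End R M) (Z.1 →ₗ[R] M)) : Y = Z := by
  have := hΦ.isLocalRing Y
  have := hΦ.isLocalRing Z
  have hZ := (hΦ.isSummand _ Z.2).1.1
  have := projective_hom (hΦ.isRetract Y)
  obtain ⟨f, hf⟩ := Module.projective_lifting_property (Submodule.mkQ _)
    (e.toLinearMap ∘ₗ Submodule.mkQ _) (Submodule.mkQ_surjective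
      (Module.jacobson (Module.End R M) (Z.1 →ₗ[R] M)))
  obtain ⟨s, p, hsp⟩ := hΦ.isRetract Y
  have hfs : f s ∉ radHom Z.1 M := by
    intro hfs
    rw [← jacobson_hom (hΦ.isRetract Z), ← Submodule.Quotient.mk_eq_zero] at hfs
    have h1 : e (Submodule.Quotient.mk s) = 0 := (LinearMap.congr_fun hf s).symm.trans hfs
    rw [map_eq_zero_iff _ e.injective, Submodule.Quotient.mk_eq_zero,
      jacobson_hom (hΦ.isRetract Y)] at h1
    exact notMem_radHom hsp h1
  rw [mem_radHom] at hfs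
  push Not at hfs
  obtain ⟨b, hb⟩ := hfs
  rw [hom_eq_precomp hsp f, precomp_apply, ← LinearMap.comp_assoc] at hb
  exact (hΦ.eq_of_equiv (LinearEquiv.ofBijective _
    ((hΦ.isSummand _ Y.2).1.bijective_of_isUnit_comp hb))).symm

/-- The action on a vector of a module over `End(M)`, restricted to a direct summand. -/
def homAction {Y : Type*} [AddCommGroup Y] [Module R Y] (p : M →ₗ[R] Y) {S : Type*}
    [AddCommGroup S] [Module (Module.End R M) S] (x : S) :
    (Y →ₗ[R] M) →ₗ[Module.End R M] S :=
  LinearMap.toSpanSingleton (Module.End R M) S x ∘ₗ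
    (precomp M p : (Y →ₗ[R] M) →ₗ[Module.End R M] Module.End R M)

/-- The identity of `M` is a sum of idempotents `s i ∘ p i`; one of them does not kill a chosen `x ≠
0`, which yields a nonzero map from that `P_Y` to `S`. -/
theorem IsIndecSummandReps.exists_top_equiv (hΦ : IsIndecSummandReps Φ) (S : Type u)
    [AddCommGroup S] [Module (Module.End R M) S] [IsSimpleModule (Module.End R M) S] :
    ∃ Y : Φ, Nonempty (S ≃ₗ[Module.End R M] top (Module.End R M) (Y.1 →ₗ[R] M)) := by
  classical
  have := IsSimpleModule.nontrivial (Module.End R M) S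
  obtain ⟨x, hx⟩ := exists_ne (0 : S)
  obtain ⟨ι, _, W, hW, ⟨e⟩⟩ := exists_equiv_pi_indecomposable R M
  choose Y hY using fun i => hΦ.exists_equiv (hW i) (IsRetract.of_equiv_pi e i)
  let E : M ≃ₗ[R] ∀ i, (Y i).1 := e ≪≫ₗ LinearEquiv.piCongrRight fun i => (hY i).some
  let s : ∀ i, (Y i).1 →ₗ[R] M := fun i =>
    E.symm.toLinearMap ∘ₗ LinearMap.single R (fun i => (Y i).1) i
  let p : ∀ i, M →ₗ[R] (Y i).1 := fun i => LinearMap.proj i ∘ₗ E.toLinearMap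
  have hsum : ∑ i, (show Module.End R M from s i ∘ₗ p i) = 1 := by
    refine LinearMap.ext fun m => ?_
    have h1 : ∑ i, Pi.single i (E m i) = E m := Finset.univ_sum_single _
    have h2 : E.symm (∑ i, Pi.single i (E m i)) = m := by rw [h1, E.symm_apply_apply]
    rw [map_sum] at h2
    rw [LinearMap.sum_apply]
    exact h2
  obtain ⟨i, hi⟩ : ∃ i, (show Module.End R M from s i ∘ₗ p i) • x ≠ 0 := by
    by_contra! h0
    refine hx ?_
    rw [← one_smul (Module.End R M) x, ← hsum, Finset.sum_smul, Finset.sum_eq_zero]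
    exact fun i _ => h0 i
  have := hΦ.isLocalRing (Y i)
  exact ⟨Y i, nonempty_equiv_top_of_ne_zero (hΦ.isRetract (Y i)) (φ := homAction (p i) x)
    fun h0 => hi (LinearMap.congr_fun h0 (s i))⟩

theorem IsIndecSummandReps.labelsSimples (hΦ : IsIndecSummandReps Φ) :
    LabelsSimples (homProj Φ) where
  projective Y := projective_hom (hΦ.isRetract Y)
  indecomposable Y := by
    have := hΦ.isLocalRing Y
    exact isIndecomposable_hom (hΦ.isRetract Y)
  isSimple_top Y := by
    have := hΦ.isLocalRing Y
    exact isSimpleModule_top_hom (hΦ.isRetract Y)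
  eq_of_top_equiv Y Z := fun ⟨e⟩ => hΦ.eq_of_top_equiv e
  exists_top_equiv S _ := hΦ.exists_top_equiv S

end Labels

/-! ### The kernels of the standard modules -/

section Kernel

theorem isPartialOrder_grLE {R M : Type u} [Ring R] [AddCommGroup M] [Module R M]
    (Φ : Set (Submodule R M)) : IsPartialOrder Φ (grLE Φ) where
  refl _ := Or.inl rfl
  trans := by
    rintro A B C (rfl | h) (rfl | h')
    exacts [Or.inl rfl, Or.inr h', Or.inr h, Or.inr (h'.trans h)]
  antisymm := by
    rintro A B (h | h) (h' | h')
    exacts [h, h, h'.symm, absurd h h'.asymm]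

variable {R : Type u} [Ring R] [IsArtinianRing R] {X : Type u} [AddCommGroup X] [Module R X]
  [Module.Finite R X] {Φ : Set (Submodule R (grSum R X))}

/-- `U_Y` consists of the homomorphisms that vanish on the reject of `Y`. -/
theorem stdKernel_le (hΦ : IsIndecSummandReps Φ) (Y : Φ) {g : Y.1 →ₗ[R] grSum R X}
    (hg : g ∈ stdKernel (grLE Φ) (homProj Φ) Y) :
    reject Y.1 (indecLT R (grMeasure R Y.1)) ≤ LinearMap.ker g := by
  let K : Submodule (Module.End R (grSum R X)) (Y.1 →ₗ[R] grSum R X) :=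
    { carrier := {g | reject Y.1 (indecLT R (grMeasure R Y.1)) ≤ LinearMap.ker g}
      zero_mem' := fun x _ => rfl
      add_mem' := fun {f g} hf hg x hx => by
        have h1 : f x = 0 := hf hx
        have h2 : g x = 0 := hg hx
        simp [h1, h2]
      smul_mem' := fun c g hg x hx => by
        have h1 : g x = 0 := hg hx
        change c (g x) = 0
        rw [h1, map_zero] }
  suffices h : stdKernel (grLE Φ) (homProj Φ) Y ≤ K from h hg
  refine iSup_le fun Z => iSup_le fun hZ => iSup_le fun f => ?_
  rintro _ ⟨g, rfl⟩
  obtain ⟨s, p, hsp⟩ := hΦ.isRetract Z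
  have hfin := (hΦ.isRetract Y).finite
  have hfin' := (hΦ.isRetract Z).finite
  -- Because measures are totally ordered, `Z ⋬ Y` means that `μ(Z) ≤ μ(Y)` and `Z ≠ Y`. The map `Y
  -- → Z` inducing `f` is then not bijective and kills the reject.
  have hle : grMeasure R Z.1 ≤ grMeasure R Y.1 := le_of_not_gt fun h => hZ (Or.inr h)
  have hf : f g = g ∘ₗ (p ∘ₗ f s) := LinearMap.congr_fun (hom_eq_precomp hsp f) g
  rcases bijective_or_reject_le_ker (hΦ.isSummand _ Y.2).1 (hΦ.isSummand _ Z.2).1 hle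
    (p ∘ₗ f s) with hb | hk
  · exact absurd (Or.inl (hΦ.eq_of_equiv (LinearEquiv.ofBijective _ hb)).symm) hZ
  · change reject Y.1 (indecLT R (grMeasure R Y.1)) ≤ LinearMap.ker (f g)
    rw [hf]
    exact hk.trans (LinearMap.ker_le_ker_comp _ _)

/-- The homomorphism of modules over `End(M)` given by precomposition with the coordinates of a
map to a finite product. -/
def piPrecomp {R Y : Type*} [Ring R] [AddCommGroup Y] [Module R Y]
    {ι : Type*} [Fintype ι] {Z : ι → Type*} [∀ i, AddCommGroup (Z i)] [∀ i, Module R (Z i)]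
    (M : Type*) [AddCommGroup M] [Module R M] (a : ∀ i, Y →ₗ[R] Z i) :
    (∀ i, Z i →ₗ[R] M) →ₗ[Module.End R M] (Y →ₗ[R] M) :=
  ∑ i, precomp M (a i) ∘ₗ LinearMap.proj i

section PiPrecomp

variable {R M Y : Type*} [Ring R] [AddCommGroup M] [Module R M] [AddCommGroup Y] [Module R Y]
  {ι : Type*} [Fintype ι] {Z : ι → Type*} [∀ i, AddCommGroup (Z i)] [∀ i, Module R (Z i)]
  {a : ∀ i, Y →ₗ[R] Z i}

theorem piPrecomp_apply (x : ∀ i, Z i →ₗ[R] M) : piPrecomp M a x = ∑ i, x i ∘ₗ a i := by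
  simp [piPrecomp]

theorem piPrecomp_injective (ha : Function.Surjective (LinearMap.pi a)) :
    Function.Injective (piPrecomp M a) := by
  classical
  refine (injective_iff_map_eq_zero _).2 fun x hx => funext fun i => LinearMap.ext fun z => ?_
  obtain ⟨y, hy⟩ := ha (Pi.single i z)
  have h1 := LinearMap.congr_fun hx y
  rw [piPrecomp_apply, LinearMap.sum_apply, Finset.sum_eq_single i] at h1
  · have h2 : a i y = z := (congrFun hy i).trans (Pi.single_eq_same i z)
    rwa [LinearMap.comp_apply, h2] at h1
  · intro j _ hj
    have h2 : a j y = 0 := (congrFun hy j).trans (Pi.single_eq_of_ne hj z)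
    rw [LinearMap.comp_apply, h2, map_zero]
  · exact fun h => absurd (Finset.mem_univ i) h

/-- Left exactness of `Hom(-, M)`: `g` factors through the quotient by the kernel, which is the
product of the `Z i`. -/
theorem mem_range_piPrecomp (ha : Function.Surjective (LinearMap.pi a)) {g : Y →ₗ[R] M}
    (hg : LinearMap.ker (LinearMap.pi a) ≤ LinearMap.ker g) :
    g ∈ LinearMap.range (piPrecomp M a) := by
  classical
  let h : (∀ i, Z i) →ₗ[R] M := (LinearMap.ker (LinearMap.pi a)).liftQ g hg ∘ₗ
    ((LinearMap.pi a).quotKerEquivOfSurjective ha).symm.toLinearMap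
  have hh : ∀ y, h (LinearMap.pi a y) = g y := by
    intro y
    have h1 : ((LinearMap.pi a).quotKerEquivOfSurjective ha).symm (LinearMap.pi a y) =
        Submodule.Quotient.mk y := by
      rw [LinearEquiv.symm_apply_eq]
      rfl
    change (LinearMap.ker (LinearMap.pi a)).liftQ g hg
      (((LinearMap.pi a).quotKerEquivOfSurjective ha).symm (LinearMap.pi a y)) = g y
    rw [h1, Submodule.liftQ_apply]
  refine ⟨fun i => h ∘ₗ LinearMap.single R Z i, LinearMap.ext fun y => ?_⟩
  rw [piPrecomp_apply, LinearMap.sum_apply, ← hh y]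
  have h1 : ∑ i, Pi.single i (a i y) = LinearMap.pi a y :=
    Finset.univ_sum_single (LinearMap.pi a y)
  rw [← h1, map_sum]
  rfl

end PiPrecomp

theorem range_piPrecomp_le_stdKernel {R X : Type u} [Ring R] [AddCommGroup X] [Module R X]
    {Φ : Set (Submodule R (grSum R X))} {Y : Φ} {ι : Type*} [Fintype ι] {Z : ι → Φ}
    {a : ∀ i, Y.1 →ₗ[R] (Z i).1} (hlt : ∀ i, grMeasure R (Z i).1 < grMeasure R Y.1) :
    LinearMap.range (piPrecomp (grSum R X) a) ≤ stdKernel (grLE Φ) (homProj Φ) Y := by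
  rintro _ ⟨x, rfl⟩
  rw [piPrecomp_apply]
  refine Submodule.sum_mem _ fun i _ => ?_
  have hr : ¬ grLE Φ (Z i) Y := by
    rintro (h | h)
    · exact (h ▸ hlt i).false
    · exact h.asymm (hlt i)
  exact (le_iSup₂_of_le (Z i) hr (le_iSup_of_le (precomp (grSum R X) (a i)) le_rfl) :
    LinearMap.range (precomp (grSum R X) (a i)) ≤ stdKernel (grLE Φ) (homProj Φ) Y) ⟨x i, rfl⟩

theorem hasStdResolutions_homProj (hΦ : IsIndecSummandReps Φ) :
    HasStdResolutions (grLE Φ) (homProj Φ) := by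
  intro Y
  obtain ⟨ι, _, Z, a, hlt, hsurj, hker⟩ := exists_pi_surjective_ker_eq_reject hΦ Y
  refine ⟨ι, inferInstance, Z, piPrecomp (grSum R X) a,
    fun i => ⟨Or.inr (hlt i), fun h => (h ▸ hlt i).false⟩, piPrecomp_injective hsurj,
    le_antisymm (range_piPrecomp_le_stdKernel hlt) fun g hg =>
      mem_range_piPrecomp hsurj (hker.trans_le (stdKernel_le hΦ Y hg))⟩

theorem mem_stdKernel (hΦ : IsIndecSummandReps Φ) (Y : Φ) (g : Y.1 →ₗ[R] grSum R X) :
    g ∈ stdKernel (grLE Φ) (homProj Φ) Y ↔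
      reject Y.1 (indecLT R (grMeasure R Y.1)) ≤ LinearMap.ker g := by
  refine ⟨stdKernel_le hΦ Y, fun hg => ?_⟩
  obtain ⟨ι, _, Z, a, hlt, hsurj, hker⟩ := exists_pi_surjective_ker_eq_reject hΦ Y
  exact range_piPrecomp_le_stdKernel hlt (mem_range_piPrecomp hsurj (hker.trans_le hg))

/-- An endomorphism of `P_Y` is precomposition with some `b : Y → Y`, and `b` is bijective or kills
the reject. -/
theorem surjective_or_range_le_stdKernel (hΦ : IsIndecSummandReps Φ) (Y : Φ)
    (f : homProj Φ Y →ₗ[Module.End R (grSum R X)] homProj Φ Y) :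
    Function.Surjective f ∨ LinearMap.range f ≤ stdKernel (grLE Φ) (homProj Φ) Y := by
  obtain ⟨s, p, hsp⟩ := hΦ.isRetract Y
  have hfin := (hΦ.isRetract Y).finite
  have hY := (hΦ.isSummand _ Y.2).1
  have hf : f = precomp (grSum R X) (p ∘ₗ f s) := hom_eq_precomp hsp f
  generalize p ∘ₗ f s = b at hf
  subst hf
  refine (bijective_or_reject_le_ker hY hY le_rfl b).imp (fun hb g => ?_) fun hk => ?_
  · refine ⟨g ∘ₗ (LinearEquiv.ofBijective b hb).symm.toLinearMap, LinearMap.ext fun y => ?_⟩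
    exact congrArg g ((LinearEquiv.ofBijective b hb).symm_apply_apply y)
  · rintro _ ⟨g, rfl⟩
    exact (mem_stdKernel hΦ Y _).2 (hk.trans (LinearMap.ker_le_ker_comp b g))

/-- The inclusion of `Y` does not kill the nonzero reject, so `U_Y` is proper and lies in the unique
maximal submodule. -/
theorem stdKernel_le_jacobson (hΦ : IsIndecSummandReps Φ) (Y : Φ) :
    stdKernel (grLE Φ) (homProj Φ) Y ≤
      Module.jacobson (Module.End R (grSum R X)) (homProj Φ Y) := by
  have := hΦ.isLocalRing Y
  have hfin := (hΦ.isRetract Y).finite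
  have := (hΦ.isSummand _ Y.2).1.1
  refine (le_radHom_of_ne_top fun ht => ?_).trans (jacobson_hom (hΦ.isRetract Y)).ge
  have h1 := stdKernel_le hΦ Y (g := Y.1.subtype) (ht ▸ Submodule.mem_top)
  rw [Submodule.ker_subtype] at h1
  exact reject_grMeasure_ne_bot Y.1 (le_bot_iff.1 h1)

end Kernel

/-! ### Endomorphism algebras over an Artin algebra -/

/-- The endomorphism ring of a finitely generated module over an Artin algebra is an Artin
algebra. -/
theorem IsArtinAlgebra.exists_algebra_end {k : Type*} {A : Type*} [CommRing k] [Ring A]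
    [Algebra k A] (hA : IsArtinAlgebra k A) (M : Type*) [AddCommGroup M] [Module A M]
    [Module.Finite A M] :
    ∃ _ : Algebra k (Module.End A M),
      (∀ (c : k) (x : M), algebraMap k (Module.End A M) c x = algebraMap k A c • x) ∧
      IsArtinAlgebra k (Module.End A M) := by
  let _ : Module k M := Module.compHom M (algebraMap k A)
  have : IsScalarTower k A M := ⟨fun c a x => by
    change (c • a) • x = algebraMap k A c • (a • x)
    rw [Algebra.smul_def, mul_smul]⟩
  have : SMulCommClass A k M := ⟨fun a c x => by
    change a • (algebraMap k A c • x) = algebraMap k A c • (a • x)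
    rw [← mul_smul, ← mul_smul, Algebra.commutes]⟩
  have := hA.artinian
  have := hA.finite
  have : Module.Finite k M := Module.Finite.trans A M
  refine ⟨inferInstance, fun c x => rfl, hA.artinian, ?_⟩
  -- Evaluation at finitely many generators embeds `End(M)` in `M^n`, which is noetherian over the
  -- artinian ring `k`.
  obtain ⟨n, v, hv⟩ := Module.Finite.exists_fin (R := A) (M := M)
  let ev : Module.End A M →ₗ[k] (Fin n → M) :=
    { toFun := fun f i => f (v i)
      map_add' := fun _ _ => rfl
      map_smul' := fun _ _ => rfl }
  refine Module.Finite.of_injective ev fun f g hfg => ?_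
  refine LinearMap.ext_on_range hv fun i => congrFun hfg i

end GabrielRoiter

theorem mainTheorem2 {k : Type w} {Λ : Type u} [CommRing k] [Ring Λ] [Algebra k Λ]
    (hΛ : GabrielRoiter.IsArtinAlgebra k Λ)
    (X : Type u) [AddCommGroup X] [Module Λ X] [Module.Finite Λ X]
    (Φ : Set (Submodule Λ (GabrielRoiter.grSum Λ X)))
    (hΦ : GabrielRoiter.IsIndecSummandReps Φ) :
    (∃ _ : Algebra k (Module.End Λ (GabrielRoiter.grSum Λ X)),
      (∀ (c : k) (x : GabrielRoiter.grSum Λ X),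
        algebraMap k (Module.End Λ (GabrielRoiter.grSum Λ X)) c x = algebraMap k Λ c • x) ∧
      GabrielRoiter.IsArtinAlgebra k (Module.End Λ (GabrielRoiter.grSum Λ X))) ∧
    GabrielRoiter.IsLeftStronglyQuasihereditary
      (GabrielRoiter.grLE Φ) (GabrielRoiter.homProj Φ) ∧
    GabrielRoiter.HasFiniteGlobalDimension (Module.End Λ (GabrielRoiter.grSum Λ X)) := by
  have := hΛ.artinian
  have := hΛ.finite
  have : IsArtinianRing Λ := IsArtinianRing.of_finite k Λ
  have hΓ := hΛ.exists_algebra_end (GabrielRoiter.grSum Λ X)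
  have hsp : IsSemiprimaryRing (Module.End Λ (GabrielRoiter.grSum Λ X)) := by
    obtain ⟨_, -, h⟩ := hΓ
    have := h.finite
    have : IsArtinianRing (Module.End Λ (GabrielRoiter.grSum Λ X)) := IsArtinianRing.of_finite k _
    infer_instance
  have := hΦ.finite
  have hq := GabrielRoiter.isLeftStronglyQuasihereditary_of_hasStdResolutions hsp
    (GabrielRoiter.isPartialOrder_grLE Φ) hΦ.labelsSimples
    (GabrielRoiter.hasStdResolutions_homProj hΦ)
    (GabrielRoiter.surjective_or_range_le_stdKernel hΦ)
  exact ⟨hΓ, hq, hq.hasFiniteGlobalDimension (GabrielRoiter.stdKernel_le_jacobson hΦ)⟩
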